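/- **Conventions.** Let $K$ be a field and $A=K[X_1,\dots,X_n]$, standard graded. For a homogeneous ideal $\mathfrak c\subseteq A$, let $\mathcal I_{A/\mathfrak c}$ be the poset of homogeneous ideals of $A/\mathfrak c$ ordered by inclusion, and $\mathcal H_{A/\mathfrak c}$ the poset of Hilbert functions $d\mapsto \dim_K I_d$ of the ideals $I\in\mathcal I_{A/\mathfrak c}$, ordered pointwise. The ring $A/\mathfrak c$ *has an embedding* if there is an order-preserving injection $\epsilon:\mathcal H_{A/\mathfrak c}\to\mathcal I_{A/\mathfrak c}$ such that the Hilbert function of $\epsilon(H)$ is $H$ for every $H\in\mathcal H_{A/\mathfrak c}$. A *distraction* $D$ of $A$ is a matrix of linear forms $l_{ij}\in A_1$ ($1\le i\le n$, $j\ge 1$) such that (i) for all $j_1,\dots,j_n\ge 1$ the forms $l_{1j_1},\dots,l_{nj_n}$ generate the $K$-vector space $A_1$, and (ii) there is $N\ge 1$ such that $l_{ij}=l_{iN}$ for all $i$ and all $j\ge N$. Put $D(X_1^{a_1}\cdots X_n^{a_n})=\prod_{i=1}^n\prod_{j=1}^{a_i}l_{ij}$; for a monomial ideal $\mathfrak c$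 of $A$, $D(\mathfrak c)$ is the homogeneous ideal generated by the distractions of the monomials of $\mathfrak c$ (equivalently, of any monomial system of generators of $\mathfrak c$). **Theorem.** Let $n\ge 1$, let $\bar{\mathfrak a}\subseteq \bar A=K[X_1,\dots,X_{n-1}]$ be a monomial ideal, let $e\in\mathbb N\cup\{\infty\}$, and let $\mathfrak a=\bar{\mathfrak a}A+X_n^eA\subseteq A=\bar A[X_n]$, where $X_n^\infty A$ denotes the zero ideal. Suppose that $\bar A/\bar{\mathfrak a}$ and $A/\mathfrak a$ have embeddings. If $\mathcal H_{\bar A/\bar D(\bar{\mathfrak a})}=\mathcal H_{\bar A/\bar{\mathfrak a}}$ for every distraction $\bar D$ of $\bar A$, then $\mathcal H_{A/D(\mathfrak a)}=\mathcal H_{A/\mathfrak a}$ for every distraction $D$ of $A$. -/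

import Mathlib

open MvPolynomial

noncomputable section

/-! Hilbert functions and their embeddings.  Here `R` is a `K`-algebra and `𝒜 d` is its
degree `d` part. -/

section HilbertFunctions

variable {K R : Type*} [Field K] [CommRing R] [Algebra K R]

/-- An ideal is homogeneous if it is generated by homogeneous elements. -/
def IsHomogIdeal (𝒜 : ℕ → Submodule K R) (J : Ideal R) : Prop :=
  ∃ S : Set R, (∀ x ∈ S, SetLike.IsHomogeneousElem 𝒜 x) ∧ J = Ideal.span S

/-- The poset of all homogeneous ideals, ordered by inclusion. -/
abbrev HomogIdeals (𝒜 : ℕ → Submodule K R) : Type _ :=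
  {J : Ideal R // IsHomogIdeal 𝒜 J}

/-- The Hilbert function of an ideal `J`: its value at `d` is `dim_K J_d`, where
`J_d = J ∩ 𝒜 d`. -/
def hilbertFun (𝒜 : ℕ → Submodule K R) (J : Ideal R) : ℕ → ℕ :=
  fun d => Module.finrank K ↥(J.restrictScalars K ⊓ 𝒜 d)

/-- The set of all Hilbert functions of homogeneous ideals; it carries the pointwise order
inherited from `ℕ → ℕ`. -/
def hilbertPoset (𝒜 : ℕ → Submodule K R) : Set (ℕ → ℕ) :=
  {H | ∃ J : Ideal R, IsHomogIdeal 𝒜 J ∧ hilbertFun 𝒜 J = H}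

/-- An embedding of Hilbert functions: an order-preserving injection from the poset of Hilbert
functions to the poset of homogeneous ideals which sends `H` to an ideal with Hilbert
function `H`. -/
structure HilbertEmbedding (𝒜 : ℕ → Submodule K R) where
  toFun : hilbertPoset 𝒜 → HomogIdeals 𝒜
  monotone : Monotone toFun
  injective : Function.Injective toFun
  hilbertFun_eq : ∀ H : hilbertPoset 𝒜, hilbertFun 𝒜 (toFun H).1 = H.1

/-- The graded ring has an embedding (of Hilbert functions). -/
def HasHilbertEmbedding (𝒜 : ℕ → Submodule K R) : Prop :=
  Nonempty (HilbertEmbedding 𝒜)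

end HilbertFunctions

section PolynomialRings

variable {K : Type*} [Field K] {n : ℕ}

/-- The standard grading of `K[X_1, …, X_n] / I`: the degree `d` part is the image of the space of
homogeneous polynomials of degree `d`.  (It is a grading when `I` is homogeneous.) -/
def quotGrading (I : Ideal (MvPolynomial (Fin n) K)) (d : ℕ) :
    Submodule K (MvPolynomial (Fin n) K ⧸ I) :=
  (homogeneousSubmodule (Fin n) K d).map (Ideal.Quotient.mkₐ K I).toLinearMap

/-- A monomial ideal: an ideal generated by a set of monomials. -/
def IsMonomialIdeal (I : Ideal (MvPolynomial (Fin n) K)) : Prop :=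
  ∃ S : Set (Fin n →₀ ℕ), I = Ideal.span ((fun s => monomial s (1 : K)) '' S)

/-- The ideal `(x ^ e)` for `e ∈ ℕ ∪ {∞}`, with `(x ^ ∞) = 0`. -/
def powIdeal {R : Type*} [CommRing R] (x : R) : ℕ∞ → Ideal R
  | ⊤ => ⊥
  | (e : ℕ) => Ideal.span {x ^ e}

/-- For an ideal `I` of `K[X_1, …, X_n]` and `e ∈ ℕ ∪ {∞}`, the ideal
`I A + X_{n+1} ^ e A` of `A = K[X_1, …, X_{n+1}]`. -/
def extendIdeal (I : Ideal (MvPolynomial (Fin n) K)) (e : ℕ∞) :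
    Ideal (MvPolynomial (Fin (n + 1)) K) :=
  I.map (rename (R := K) (Fin.castSucc (n := n))) ⊔ powIdeal (X (Fin.last n)) e

variable (K n) in
/-- A distraction of `A = K[X_1, …, X_n]`: a matrix of linear forms with `n` rows and infinitely
many columns (numbered from `0` here), such that any choice of one entry from each row gives a
system of generators of the vector space `A_1`, and such that the columns are eventually
constant. -/
structure Distraction where
  entry : Fin n → ℕ → MvPolynomial (Fin n) K
  mem_linear : ∀ i j, entry i j ∈ homogeneousSubmodule (Fin n) K 1
  span_eq : ∀ c : Fin n → ℕ,
    Submodule.span K (Set.range fun i => entry i (c i)) = homogeneousSubmodule (Fin n) K 1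
  eventually_const : ∃ N : ℕ, ∀ i, ∀ j, N ≤ j → entry i j = entry i N

namespace Distraction

/-- The distraction of the monomial `X ^ a`: the product over `i` of the first `a i` entries of
row `i`. -/
def onMonomial (D : Distraction K n) (a : Fin n →₀ ℕ) : MvPolynomial (Fin n) K :=
  ∏ i, ∏ j ∈ Finset.range (a i), D.entry i j

/-- The distraction `D(I)` of a monomial ideal `I`: the ideal generated by the distractions of the
monomials of `I`. -/
def onIdeal (D : Distraction K n) (I : Ideal (MvPolynomial (Fin n) K)) :
    Ideal (MvPolynomial (Fin n) K) :=
  Ideal.span (D.onMonomial '' {a | monomial a (1 : K) ∈ I})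

/-- `D(I)` may be computed from any monomial system of generators of `I`. -/
theorem onIdeal_span (D : Distraction K n) (S : Set (Fin n →₀ ℕ)) :
    D.onIdeal (Ideal.span ((fun s => monomial s (1 : K)) '' S)) =
      Ideal.span (D.onMonomial '' S) := by
  apply le_antisymm
  · refine Ideal.span_le.2 ?_
    rintro _ ⟨a, ha, rfl⟩
    have ha' := (mem_ideal_span_monomial_image (R := K)).1 ha a (by simp)
    obtain ⟨s, hs, hsa⟩ := ha'
    refine Ideal.mem_of_dvd _ ?_ (Ideal.subset_span ⟨s, hs, rfl⟩)
    exact Finset.prod_dvd_prod_of_dvd _ _ fun i _ =>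
      Finset.prod_dvd_prod_of_subset _ _ _ (Finset.range_mono (hsa i))
  · refine Ideal.span_mono (Set.image_mono fun s hs => ?_)
    exact Ideal.subset_span ⟨s, hs, rfl⟩

end Distraction

end PolynomialRings

end

/-! Homogeneous ideals of `A/c` are handled as graded families: subspaces of the forms of each
degree, stable under the variables and containing the pieces of `c`. A distraction extends to a
bijective graded linear map carrying monomial ideals to their distractions, so it preserves their
Hilbert functions. Passing to initial ideals, every Hilbert function of `A/a` is therefore one of
`A/D(a)`; this needs no embedding.

For the converse, an embedding can be read degree by degree: the degree `d` piece of the chosen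
ideal increases with the dimension in degree `d` alone (`FlagMap`). For `A/a` this means that a
dimension sequence is realised above `a` as soon as it is realised in each pair of consecutive
degrees (`FlagMap.exists_isGradedFamily`).

So fix `d` and an ideal `J` containing `D(a)`, made full from degree `d + 2` on. It contains the
product of the first `N` entries of the last row, where `N = e`, or `N = d + 2` if `e = ∞`. For such
an entry `l`, the dimension of `J` in degree `k + 1` is that of its image modulo `l` in degree `k +
1` plus that of `(J : l)` in degree `k`. Dividing by the `N` entries one after another cuts `J` into
slices in one variable less, each above a distraction of the smaller ideal. By hypothesis each slice
has the dimensions of a family above the smaller ideal itself; its flag map puts these in position,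
and `stack` adds up `L i * X_n ^ i`.

Stability under `X_n` from degree `d` to `d + 1` asks that `L i ≤ L (i + 1)` in degree `d - i`. This
is achieved by dividing each time by a remaining entry whose slice is smallest in that degree, since
passing to colon ideals only enlarges the later slices (`exists_stack_finrank_eq`). The order of the
entries depends on `d`, which is why the problem is first reduced to two consecutive degrees. -/

noncomputable section

/-! ### Graded families and homogeneous ideals of a polynomial ring -/

section GradedFamilies

variable {K : Type*} [Field K] {n : ℕ}

/-- The sequences of vector spaces that occur as the graded pieces of homogeneous ideals of a
polynomial ring. -/
structure IsGradedFamily (W : ℕ → Submodule K (MvPolynomial (Fin n) K)) : Prop where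
  le : ∀ d, W d ≤ homogeneousSubmodule (Fin n) K d
  X_mul_mem : ∀ d i f, f ∈ W d → X i * f ∈ W (d + 1)

/-- The degree `d` part of an ideal of a polynomial ring. -/
def degreePart (J : Ideal (MvPolynomial (Fin n) K)) (d : ℕ) :
    Submodule K (MvPolynomial (Fin n) K) :=
  J.restrictScalars K ⊓ homogeneousSubmodule (Fin n) K d

theorem degreePart_mono {I J : Ideal (MvPolynomial (Fin n) K)} (h : I ≤ J) (d : ℕ) :
    degreePart I d ≤ degreePart J d :=
  fun _ hf => ⟨h hf.1, hf.2⟩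

instance finite_homogeneousSubmodule (d : ℕ) :
    Module.Finite K (homogeneousSubmodule (Fin n) K d) :=
  Module.Finite.iff_fg.2 (homogeneousSubmodule_fg (Fin n) K d)

theorem finite_of_le_homogeneousSubmodule {V : Submodule K (MvPolynomial (Fin n) K)} {d : ℕ}
    (h : V ≤ homogeneousSubmodule (Fin n) K d) : Module.Finite K V :=
  Module.Finite.of_injective (Submodule.inclusion h) (Submodule.inclusion_injective h)

theorem isHomogeneous_mul_left {l f : MvPolynomial (Fin n) K} {d : ℕ}
    (hl : l.IsHomogeneous 1) (hf : f.IsHomogeneous d) : (l * f).IsHomogeneous (d + 1) := by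
  rw [add_comm]; exact hl.mul hf

theorem degreePart_isGradedFamily (J : Ideal (MvPolynomial (Fin n) K)) :
    IsGradedFamily (degreePart J) where
  le _ := inf_le_right
  X_mul_mem _ i _ hf := ⟨J.mul_mem_left _ hf.1, isHomogeneous_mul_left (isHomogeneous_X K i) hf.2⟩

theorem homogeneousSubmodule_isGradedFamily :
    IsGradedFamily (homogeneousSubmodule (Fin n) K) where
  le _ := le_rfl
  X_mul_mem _ i _ hf := isHomogeneous_mul_left (isHomogeneous_X K i) hf

theorem homogeneousComponent_linear_mul {l : MvPolynomial (Fin n) K} (hl : l.IsHomogeneous 1)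
    (d : ℕ) (f : MvPolynomial (Fin n) K) :
    homogeneousComponent (d + 1) (l * f) = l * homogeneousComponent d f := by
  conv_lhs => rw [← sum_homogeneousComponent f, Finset.mul_sum, map_sum]
  conv_rhs => rw [← sum_homogeneousComponent f, map_sum, Finset.mul_sum]
  refine Finset.sum_congr rfl fun k _ => ?_
  rw [homogeneousComponent_of_mem (isHomogeneous_mul_left hl (homogeneousComponent_mem k f)),
    homogeneousComponent_of_mem (homogeneousComponent_mem k f)]
  by_cases h : d = k <;> simp [h]

theorem homogeneousComponent_zero_linear_mul {l : MvPolynomial (Fin n) K}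
    (hl : l.IsHomogeneous 1) (f : MvPolynomial (Fin n) K) :
    homogeneousComponent 0 (l * f) = 0 := by
  conv_lhs => rw [← sum_homogeneousComponent f, Finset.mul_sum, map_sum]
  refine Finset.sum_eq_zero fun k _ => ?_
  rw [homogeneousComponent_of_mem (isHomogeneous_mul_left hl (homogeneousComponent_mem k f))]
  simp

theorem homogeneousComponent_mem_span {S : Set (MvPolynomial (Fin n) K)}
    (hS : ∀ f ∈ S, ∃ d, f.IsHomogeneous d) {f : MvPolynomial (Fin n) K}
    (hf : f ∈ Ideal.span S) (d : ℕ) : homogeneousComponent d f ∈ Ideal.span S := by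
  let : GradedAlgebra (homogeneousSubmodule (Fin n) K) := MvPolynomial.gradedAlgebra
  exact homogeneousComponent_mem_of_mem (Ideal.homogeneous_span _ _ hS) hf d

theorem mem_of_forall_homogeneousComponent_mem {J : Ideal (MvPolynomial (Fin n) K)}
    {f : MvPolynomial (Fin n) K} (h : ∀ d, homogeneousComponent d f ∈ J) : f ∈ J := by
  rw [← sum_homogeneousComponent f]
  exact Ideal.sum_mem _ fun d _ => h d

namespace IsGradedFamily

variable {W W' : ℕ → Submodule K (MvPolynomial (Fin n) K)}

theorem finite (hW : IsGradedFamily W) (d : ℕ) : Module.Finite K (W d) :=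
  finite_of_le_homogeneousSubmodule (hW.le d)

theorem linear_mul_mem (hW : IsGradedFamily W) {l f : MvPolynomial (Fin n) K}
    (hl : l.IsHomogeneous 1) {d : ℕ} (hf : f ∈ W d) : l * f ∈ W (d + 1) := by
  have hl' : l ∈ homogeneousSubmodule (Fin n) K 1 := hl
  rw [homogeneousSubmodule_one_eq_span_X] at hl'
  refine Submodule.span_induction ?_ ?_ ?_ ?_ hl'
  · rintro _ ⟨i, rfl⟩
    exact hW.X_mul_mem d i f hf
  · simp
  · intro x y _ _ hx hy
    rw [add_mul]
    exact add_mem hx hy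
  · intro a x _ hx
    rw [smul_mul_assoc]
    exact Submodule.smul_mem _ a hx

theorem homogeneousComponent_mul_mem (hW : IsGradedFamily W) {f : MvPolynomial (Fin n) K}
    (hf : ∀ d, homogeneousComponent d f ∈ W d) (g : MvPolynomial (Fin n) K) :
    ∀ d, homogeneousComponent d (g * f) ∈ W d := by
  induction g using MvPolynomial.induction_on with
  | C a =>
    intro d
    rw [homogeneousComponent_C_mul, ← smul_eq_C_mul]
    exact Submodule.smul_mem _ a (hf d)
  | add p q hp hq =>
    intro d
    rw [add_mul, map_add]
    exact add_mem (hp d) (hq d)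
  | mul_X p i hp =>
    intro d
    rw [mul_comm p, mul_assoc]
    cases d with
    | zero =>
      rw [homogeneousComponent_zero_linear_mul (isHomogeneous_X K i)]
      exact zero_mem _
    | succ d =>
      rw [homogeneousComponent_linear_mul (isHomogeneous_X K i)]
      exact hW.X_mul_mem d i _ (hp d)

/-- The ideal whose graded pieces are the members of a graded family. -/
def toIdeal (hW : IsGradedFamily W) : Ideal (MvPolynomial (Fin n) K) where
  carrier := {f | ∀ d, homogeneousComponent d f ∈ W d}
  add_mem' hf hg d := by
    rw [map_add]
    exact add_mem (hf d) (hg d)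
  zero_mem' d := by
    rw [map_zero]
    exact zero_mem _
  smul_mem' g _ hf := hW.homogeneousComponent_mul_mem hf g

theorem mem_toIdeal_of_mem (hW : IsGradedFamily W) {f : MvPolynomial (Fin n) K} {d : ℕ}
    (hf : f ∈ W d) : f ∈ hW.toIdeal := by
  intro k
  rw [homogeneousComponent_of_mem (hW.le d hf)]
  split_ifs with h
  · exact h ▸ hf
  · exact zero_mem _

theorem degreePart_toIdeal (hW : IsGradedFamily W) : degreePart hW.toIdeal = W := by
  funext d
  refine le_antisymm (fun f hf => ?_) fun f hf => ⟨hW.mem_toIdeal_of_mem hf, hW.le d hf⟩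
  have := hf.1 d
  rwa [homogeneousComponent_eq_self hf.2] at this

theorem toIdeal_eq_span (hW : IsGradedFamily W) :
    hW.toIdeal = Ideal.span {f | ∃ d, f ∈ W d} := by
  refine le_antisymm (fun f hf => ?_) (Ideal.span_le.2 ?_)
  · exact mem_of_forall_homogeneousComponent_mem fun d => Ideal.subset_span ⟨d, hf d⟩
  · rintro f ⟨d, hf⟩
    exact hW.mem_toIdeal_of_mem hf

theorem le_toIdeal (hW : IsGradedFamily W) {c : Ideal (MvPolynomial (Fin n) K)}
    (hc : ∀ f ∈ c, ∀ d, homogeneousComponent d f ∈ c) (hcW : ∀ d, degreePart c d ≤ W d) :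
    c ≤ hW.toIdeal :=
  fun f hf d => hcW d ⟨hc f hf d, homogeneousComponent_mem d f⟩

/-- Changing a graded family below degree `k` to a smaller one. -/
theorem truncate_below (hW : IsGradedFamily W) (hW' : IsGradedFamily W') (h : ∀ d, W d ≤ W' d)
    (k : ℕ) : IsGradedFamily fun d => if d < k then W d else W' d where
  le d := by
    split_ifs
    · exact hW.le d
    · exact hW'.le d
  X_mul_mem d i f hf := by
    by_cases h2 : d + 1 < k
    · rw [if_pos (by omega)] at hf
      rw [if_pos h2]
      exact hW.X_mul_mem d i f hf
    · rw [if_neg h2]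
      refine hW'.X_mul_mem d i f ?_
      split_ifs at hf
      · exact h d hf
      · exact hf

end IsGradedFamily

/-! ### Hilbert functions of quotients, and embeddings read degree by degree -/

section Quotient

variable (c : Ideal (MvPolynomial (Fin n) K))

/-- The graded pieces of the preimage of an ideal of a quotient of a polynomial ring. -/
def comapFamily (J : Ideal (MvPolynomial (Fin n) K ⧸ c)) :
    ℕ → Submodule K (MvPolynomial (Fin n) K) :=
  degreePart (J.comap (Ideal.Quotient.mk c))

theorem comapFamily_isGradedFamily (J : Ideal (MvPolynomial (Fin n) K ⧸ c)) :
    IsGradedFamily (comapFamily c J) :=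
  degreePart_isGradedFamily _

theorem degreePart_le_comapFamily (J : Ideal (MvPolynomial (Fin n) K ⧸ c)) (d : ℕ) :
    degreePart c d ≤ comapFamily c J d :=
  degreePart_mono (fun f hf => by
    rw [Ideal.mem_comap, Ideal.Quotient.eq_zero_iff_mem.2 hf]
    exact zero_mem _) d

theorem comapFamily_mono {J J' : Ideal (MvPolynomial (Fin n) K ⧸ c)} (h : J ≤ J') (d : ℕ) :
    comapFamily c J d ≤ comapFamily c J' d :=
  degreePart_mono (Ideal.comap_mono h) d

theorem finrank_map_add_finrank_of_ker {V V' : Type*} [AddCommGroup V] [Module K V]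
    [AddCommGroup V'] [Module K V'] (f : V →ₗ[K] V') (W : Submodule K V) [Module.Finite K W] :
    Module.finrank K (W.map f) + Module.finrank K ↥(W ⊓ LinearMap.ker f) =
      Module.finrank K W := by
  rw [← LinearMap.finrank_range_add_finrank_ker (f.domRestrict W), LinearMap.range_domRestrict]
  congr 1
  have h : Submodule.map W.subtype (LinearMap.ker (f.domRestrict W)) = W ⊓ LinearMap.ker f := by
    rw [LinearMap.ker_domRestrict, Submodule.map_comap_subtype]
  rw [← h]
  exact (Submodule.equivMapOfInjective W.subtype W.injective_subtype _).finrank_eq.symm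

/-- Rank-nullity for the quotient map on the preimage of `J`. The additive form avoids truncated
subtraction. -/
theorem hilbertFun_add_finrank (J : Ideal (MvPolynomial (Fin n) K ⧸ c)) (d : ℕ) :
    hilbertFun (quotGrading c) J d + Module.finrank K (degreePart c d) =
      Module.finrank K (comapFamily c J d) := by
  have := (comapFamily_isGradedFamily c J).finite d
  rw [← finrank_map_add_finrank_of_ker (Ideal.Quotient.mkₐ K c).toLinearMap
    (comapFamily c J d)]
  have h1 : J.restrictScalars K ⊓ quotGrading c d =
      (comapFamily c J d).map (Ideal.Quotient.mkₐ K c).toLinearMap := by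
    ext y
    constructor
    · rintro ⟨hy, f, hf, rfl⟩
      exact ⟨f, ⟨hy, hf⟩, rfl⟩
    · rintro ⟨f, hf, rfl⟩
      exact ⟨hf.1, f, hf.2, rfl⟩
  have h2 : degreePart c d =
      comapFamily c J d ⊓ LinearMap.ker (Ideal.Quotient.mkₐ K c).toLinearMap := by
    ext f
    constructor
    · intro hf
      exact ⟨degreePart_le_comapFamily c J d hf, Ideal.Quotient.eq_zero_iff_mem.2 hf.1⟩
    · intro hf
      exact ⟨Ideal.Quotient.eq_zero_iff_mem.1 hf.2, hf.1.2⟩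
  rw [hilbertFun, h1, h2]

variable {c}

theorem exists_homogIdeal_of_isGradedFamily (hc : ∀ f ∈ c, ∀ d, homogeneousComponent d f ∈ c)
    {W : ℕ → Submodule K (MvPolynomial (Fin n) K)} (hW : IsGradedFamily W)
    (hcW : ∀ d, degreePart c d ≤ W d) :
    ∃ J, IsHomogIdeal (quotGrading c) J ∧ comapFamily c J = W := by
  refine ⟨hW.toIdeal.map (Ideal.Quotient.mk c),
    ⟨Ideal.Quotient.mk c '' {f | ∃ d, f ∈ W d}, ?_, ?_⟩, ?_⟩
  · rintro _ ⟨f, ⟨d, hf⟩, rfl⟩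
    exact ⟨d, f, hW.le d hf, rfl⟩
  · rw [hW.toIdeal_eq_span, Ideal.map_span]
  · rw [comapFamily, Ideal.comap_map_of_surjective _ Ideal.Quotient.mk_surjective,
      ← RingHom.ker_eq_comap_bot, Ideal.mk_ker, sup_eq_left.2 (hW.le_toIdeal hc hcW),
      hW.degreePart_toIdeal]

theorem mem_hilbertPoset_quotGrading (hc : ∀ f ∈ c, ∀ d, homogeneousComponent d f ∈ c)
    {H : ℕ → ℕ} :
    H ∈ hilbertPoset (quotGrading c) ↔ ∃ W, IsGradedFamily W ∧ (∀ d, degreePart c d ≤ W d) ∧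
      ∀ d, H d + Module.finrank K (degreePart c d) = Module.finrank K (W d) := by
  constructor
  · rintro ⟨J, -, rfl⟩
    exact ⟨comapFamily c J, comapFamily_isGradedFamily c J, degreePart_le_comapFamily c J,
      hilbertFun_add_finrank c J⟩
  · rintro ⟨W, hW, hcW, hH⟩
    obtain ⟨J, hJ, rfl⟩ := exists_homogIdeal_of_isGradedFamily hc hW hcW
    refine ⟨J, hJ, funext fun d => ?_⟩
    have := hilbertFun_add_finrank c J d
    have := hH d
    omega

/-- A choice, for every graded family above `c`, of a graded family above `c` with the same
dimensions, whose degree `d` part increases with the dimension in degree `d` alone. -/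
structure FlagMap (c : Ideal (MvPolynomial (Fin n) K)) where
  toFun : (ℕ → Submodule K (MvPolynomial (Fin n) K)) →
    ℕ → Submodule K (MvPolynomial (Fin n) K)
  isGradedFamily : ∀ W, IsGradedFamily W → (∀ d, degreePart c d ≤ W d) → IsGradedFamily (toFun W)
  le : ∀ W, IsGradedFamily W → (∀ d, degreePart c d ≤ W d) → ∀ d, degreePart c d ≤ toFun W d
  finrank_eq : ∀ W, IsGradedFamily W → (∀ d, degreePart c d ≤ W d) →
    ∀ d, Module.finrank K (toFun W d) = Module.finrank K (W d)
  mono : ∀ W W', IsGradedFamily W → (∀ d, degreePart c d ≤ W d) → IsGradedFamily W' →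
    (∀ d, degreePart c d ≤ W' d) → ∀ d, Module.finrank K (W d) ≤ Module.finrank K (W' d) →
    toFun W d ≤ toFun W' d

-- An embedding compares only whole Hilbert functions, but two families can be altered outside
-- degree `k` to agree there without changing the degree `k` piece of their images. Comparison in
-- degree `k` then reduces to comparison of whole functions.
open Classical in
theorem HasHilbertEmbedding.nonempty_flagMap
    (hc : ∀ f ∈ c, ∀ d, homogeneousComponent d f ∈ c)
    (h : HasHilbertEmbedding (quotGrading c)) : Nonempty (FlagMap c) := by
  obtain ⟨ε⟩ := h
  set Above : (ℕ → Submodule K (MvPolynomial (Fin n) K)) → Prop := fun W =>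
    IsGradedFamily W ∧ ∀ d, degreePart c d ≤ W d with hAbove
  have hdef : ∀ W, Above W → (fun d => Module.finrank K (W d) - Module.finrank K (degreePart c d)) ∈
      hilbertPoset (quotGrading c) := by
    intro W hW
    refine (mem_hilbertPoset_quotGrading hc).2 ⟨W, hW.1, hW.2, fun d => ?_⟩
    have := hW.1.finite d
    have := Submodule.finrank_mono (hW.2 d)
    omega
  set E : (ℕ → Submodule K (MvPolynomial (Fin n) K)) →
      ℕ → Submodule K (MvPolynomial (Fin n) K) := fun W =>
    if hW : Above W then comapFamily c (ε.toFun ⟨_, hdef W hW⟩).1 else W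
  have hEapp : ∀ W (hW : Above W), E W = comapFamily c (ε.toFun ⟨_, hdef W hW⟩).1 :=
    fun W hW => dif_pos hW
  have hEfam : ∀ W, Above W → Above (E W) := by
    intro W hW
    rw [hEapp W hW]
    exact ⟨comapFamily_isGradedFamily c _, degreePart_le_comapFamily c _⟩
  have hErank : ∀ W, Above W → ∀ d, Module.finrank K (E W d) = Module.finrank K (W d) := by
    intro W hW d
    rw [hEapp W hW]
    rw [← hilbertFun_add_finrank, ε.hilbertFun_eq]
    have := hW.1.finite d
    have := Submodule.finrank_mono (hW.2 d)
    dsimp only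
    omega
  have hEmono : ∀ W W', Above W → Above W' →
      (∀ d, Module.finrank K (W d) ≤ Module.finrank K (W' d)) → ∀ d, E W d ≤ E W' d := by
    intro W W' hW hW' hle d
    rw [hEapp W hW, hEapp W' hW']
    refine comapFamily_mono c (ε.monotone ?_) d
    exact Subtype.mk_le_mk.2 fun k => Nat.sub_le_sub_right (hle k) _
  have hcfam := degreePart_isGradedFamily c
  -- `T W k` agrees with `W` in degree `k`, with `c` below and with the whole ring above.
  set T : (ℕ → Submodule K (MvPolynomial (Fin n) K)) → ℕ →
      ℕ → Submodule K (MvPolynomial (Fin n) K) := fun W k d =>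
    if d < k then degreePart c d else
      (if d < k + 1 then W d else homogeneousSubmodule (Fin n) K d) with hT
  have hTfam : ∀ W, Above W → ∀ k, Above (T W k) := by
    intro W hW k
    have h1 := hW.1.truncate_below homogeneousSubmodule_isGradedFamily hW.1.le (k + 1)
    have h2 : ∀ d, degreePart c d ≤
        if d < k + 1 then W d else homogeneousSubmodule (Fin n) K d := by
      intro d
      split_ifs
      · exact hW.2 d
      · exact hcfam.le d
    refine ⟨hcfam.truncate_below h1 h2 k, fun d => ?_⟩
    simp only [hT]
    split_ifs
    · exact le_rfl
    · exact hW.2 d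
    · exact hcfam.le d
  -- The family `U`, equal to `c` below `k` and to `W` from `k` on, lies inside both `W` and `T W
  -- k`, and all three agree in degree `k`. Monotonicity plus equal dimensions turn the two
  -- inclusions into equalities.
  have hTE : ∀ W, Above W → ∀ k, E W k = E (T W k) k := by
    intro W hW k
    set U : ℕ → Submodule K (MvPolynomial (Fin n) K) := fun d =>
      if d < k then degreePart c d else W d with hU
    have hUfam : Above U := by
      refine ⟨hcfam.truncate_below hW.1 hW.2 k, fun d => ?_⟩
      simp only [hU]
      split_ifs
      · exact le_rfl
      · exact hW.2 d
    have hUk : U k = W k := by simp [hU]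
    have hTk : T W k k = W k := by simp [hT]
    have e1 : E U k = E W k := by
      have := (hEfam W hW).1.finite k
      refine Submodule.eq_of_le_of_finrank_eq (hEmono U W hUfam hW (fun d => ?_) k) ?_
      · have := hW.1.finite d
        refine Submodule.finrank_mono ?_
        simp only [hU]
        split_ifs
        · exact hW.2 d
        · exact le_rfl
      · rw [hErank U hUfam, hErank W hW, hUk]
    have e2 : E U k = E (T W k) k := by
      have := (hEfam _ (hTfam W hW k)).1.finite k
      refine Submodule.eq_of_le_of_finrank_eq (hEmono U _ hUfam (hTfam W hW k) (fun d => ?_) k) ?_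
      · have := (hTfam W hW k).1.finite d
        refine Submodule.finrank_mono ?_
        simp only [hU, hT]
        split_ifs
        · exact le_rfl
        · exact le_rfl
        · exact hW.1.le d
      · rw [hErank U hUfam, hErank _ (hTfam W hW k), hUk, hTk]
    rw [← e1, e2]
  refine ⟨⟨E, fun W h1 h2 => (hEfam W ⟨h1, h2⟩).1, fun W h1 h2 => (hEfam W ⟨h1, h2⟩).2,
    fun W h1 h2 => hErank W ⟨h1, h2⟩, fun W W' h1 h2 h1' h2' k hk => ?_⟩⟩
  rw [hTE W ⟨h1, h2⟩ k, hTE W' ⟨h1', h2'⟩ k]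
  refine hEmono _ _ (hTfam W ⟨h1, h2⟩ k) (hTfam W' ⟨h1', h2'⟩ k) (fun d => ?_) k
  rcases lt_trichotomy d k with hd | rfl | hd
  · have e : T W k d = T W' k d := by simp [hT, hd]
    rw [e]
  · have e : ∀ V, T V d d = V d := fun V => by simp [hT]
    rw [e, e]
    exact hk
  · have e : T W k d = T W' k d := by
      simp [hT, hd.not_gt, hd.not_ge]
    rw [e]

end Quotient

end GradedFamilies

/-! ### Monomial ideals and initial ideals -/

section MonomialIdeals

variable {K : Type*} [Field K] {n : ℕ}

theorem mem_span_monomial {S : Set (Fin n →₀ ℕ)} {f : MvPolynomial (Fin n) K}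
    (h : ∀ a ∈ f.support, a ∈ S) :
    f ∈ Submodule.span K ((fun a => monomial a (1 : K)) '' S) := by
  rw [f.as_sum]
  refine Submodule.sum_mem _ fun a ha => ?_
  rw [← mul_one (coeff a f), ← smul_eq_mul, ← smul_monomial]
  exact Submodule.smul_mem _ _ (Submodule.subset_span ⟨a, h a ha, rfl⟩)

theorem IsMonomialIdeal.monomial_mem {M : Ideal (MvPolynomial (Fin n) K)}
    (hM : IsMonomialIdeal M) {f : MvPolynomial (Fin n) K} (hf : f ∈ M) {a : Fin n →₀ ℕ}
    (ha : a ∈ f.support) : monomial a (1 : K) ∈ M := by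
  obtain ⟨S, rfl⟩ := hM
  obtain ⟨s, hs, hsa⟩ := mem_ideal_span_monomial_image.1 hf a ha
  refine mem_ideal_span_monomial_image.2 fun b hb => ⟨s, hs, ?_⟩
  rw [Finset.mem_singleton.1 (support_monomial_subset hb)]
  exact hsa

theorem IsMonomialIdeal.restrictScalars_eq_span {M : Ideal (MvPolynomial (Fin n) K)}
    (hM : IsMonomialIdeal M) :
    M.restrictScalars K =
      Submodule.span K ((fun a => monomial a (1 : K)) '' {a | monomial a (1 : K) ∈ M}) := by
  refine le_antisymm (fun f hf => mem_span_monomial fun a ha => hM.monomial_mem hf ha)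
    (Submodule.span_le.2 ?_)
  rintro _ ⟨a, ha, rfl⟩
  exact ha

theorem IsMonomialIdeal.homogeneousComponent_mem {M : Ideal (MvPolynomial (Fin n) K)}
    (hM : IsMonomialIdeal M) : ∀ f ∈ M, ∀ d, homogeneousComponent d f ∈ M := by
  obtain ⟨S, rfl⟩ := hM
  intro f hf d
  refine homogeneousComponent_mem_span ?_ hf d
  rintro _ ⟨s, -, rfl⟩
  exact ⟨_, isHomogeneous_monomial _ rfl⟩

/-- The exponents of the lexicographic leading monomials of the nonzero members of `V`. -/
def leadingExponents (V : Submodule K (MvPolynomial (Fin n) K)) : Set (Fin n →₀ ℕ) :=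
  {a | ∃ f ∈ V, f ≠ 0 ∧ MonomialOrder.lex.degree f = a}

theorem linearIndependent_of_degree_eq {E : Set (Fin n →₀ ℕ)} (f : E → MvPolynomial (Fin n) K)
    (h0 : ∀ a, f a ≠ 0) (hf : ∀ a, MonomialOrder.lex.degree (f a) = a) :
    LinearIndependent K f := by
  classical
  rw [linearIndependent_iff']
  intro s g hg
  by_contra! hne
  obtain ⟨i, hi, hgi⟩ := hne
  obtain ⟨j, hj, hmax⟩ := Finset.exists_max_image (s.filter fun a => g a ≠ 0)
    (fun a : E => MonomialOrder.lex.toSyn (a : Fin n →₀ ℕ)) ⟨i, by simp [hi, hgi]⟩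
  rw [Finset.mem_filter] at hj
  have hc := congrArg (coeff (j : Fin n →₀ ℕ)) hg
  rw [coeff_sum, coeff_zero, Finset.sum_eq_single j] at hc
  · rw [coeff_smul, smul_eq_mul] at hc
    rcases mul_eq_zero.1 hc with h | h
    · exact hj.2 h
    · refine h0 j (MonomialOrder.lex.coeff_degree_eq_zero_iff.1 ?_)
      rw [hf]
      exact h
  · intro b hb hbj
    by_cases hgb : g b = 0
    · simp [hgb]
    · rw [coeff_smul, MonomialOrder.lex.coeff_eq_zero_of_lt, smul_zero]
      rw [hf]
      refine lt_of_le_of_ne (hmax b (by simp [hb, hgb])) fun h => hbj ?_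
      exact Subtype.ext (MonomialOrder.lex.toSyn.injective h)
  · exact fun h => absurd hj.1 h

/-- Members with distinct leading exponents are independent, which gives one inequality. For the
other, a member whose coefficients at all leading exponents vanish has no leading term, so it is
zero. -/
theorem finrank_eq_finrank_span_leadingExponents (V : Submodule K (MvPolynomial (Fin n) K))
    [Module.Finite K V] :
    Module.finrank K (Submodule.span K ((fun a => monomial a (1 : K)) '' leadingExponents V)) =
      Module.finrank K V := by
  classical
  choose f hfV hf0 hfdeg using fun a : leadingExponents V => a.2
  have hli : LinearIndependent K f := linearIndependent_of_degree_eq f hf0 hfdeg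
  have hli' : LinearIndependent K (fun a => (⟨f a, hfV a⟩ : V)) :=
    LinearIndependent.of_comp V.subtype hli
  have hfin : Finite (leadingExponents V) := hli'.finite
  have := Fintype.ofFinite (leadingExponents V)
  have hmon : LinearIndependent K fun a : leadingExponents V => monomial (a : Fin n →₀ ℕ) (1 : K) :=
    (basisMonomials (Fin n) K).linearIndependent.comp _ Subtype.val_injective
  rw [Set.image_eq_range, finrank_span_eq_card hmon]
  refine le_antisymm hli'.fintype_card_le_finrank ?_
  let φ : V →ₗ[K] (leadingExponents V → K) :=
    LinearMap.pi fun a => (lcoeff K (a : Fin n →₀ ℕ)).comp V.subtype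
  have hφ : Function.Injective φ := by
    rw [injective_iff_map_eq_zero]
    intro v hv
    by_contra hv0
    have hv0' : (v : MvPolynomial (Fin n) K) ≠ 0 := fun h => hv0 (Subtype.ext h)
    refine MonomialOrder.lex.coeff_degree_ne_zero_iff.2 hv0' ?_
    exact congrFun hv ⟨_, v, v.2, hv0', rfl⟩
  exact (LinearMap.finrank_le_finrank_of_injective hφ).trans_eq (Module.finrank_fintype_fun_eq_card K)

/-- The initial ideal: a monomial ideal with the dimensions of a given graded family. -/
theorem IsGradedFamily.exists_isMonomialIdeal {W : ℕ → Submodule K (MvPolynomial (Fin n) K)}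
    (hW : IsGradedFamily W) {c : Ideal (MvPolynomial (Fin n) K)} (hc : IsMonomialIdeal c)
    (hcW : ∀ d, degreePart c d ≤ W d) :
    ∃ M, IsMonomialIdeal M ∧ c ≤ M ∧
      ∀ d, Module.finrank K (degreePart M d) = Module.finrank K (W d) := by
  set E : Set (Fin n →₀ ℕ) := {a | ∃ d, a ∈ leadingExponents (W d)} with hE
  have hdeg : ∀ d, ∀ a ∈ leadingExponents (W d), a.degree = d := by
    rintro d a ⟨f, hf, hf0, rfl⟩
    by_contra h
    exact MonomialOrder.lex.coeff_degree_ne_zero_iff.2 hf0 ((hW.le d hf).coeff_eq_zero h)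
  have hstep : ∀ a ∈ E, ∀ b, a + b ∈ E := by
    classical
    rintro a ⟨d, f, hf, hf0, rfl⟩ b
    have hmem : monomial b 1 * f ∈ degreePart hW.toIdeal (b.degree + d) :=
      ⟨Ideal.mul_mem_left _ _ (hW.mem_toIdeal_of_mem hf),
        (isHomogeneous_monomial 1 rfl).mul (hW.le d hf)⟩
    rw [hW.degreePart_toIdeal] at hmem
    have hb : monomial b (1 : K) ≠ 0 := by simp
    refine ⟨_, _, hmem, mul_ne_zero hb hf0, ?_⟩
    rw [MonomialOrder.degree_mul hb hf0, MonomialOrder.degree_monomial, if_neg one_ne_zero,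
      add_comm]
  refine ⟨Ideal.span ((fun a => monomial a (1 : K)) '' E), ⟨E, rfl⟩, ?_, fun d => ?_⟩
  · obtain ⟨S, rfl⟩ := hc
    refine Ideal.span_mono (Set.image_mono fun s hs => ?_)
    refine ⟨s.degree, monomial s 1, hcW _ ⟨Ideal.subset_span ⟨s, hs, rfl⟩,
      isHomogeneous_monomial _ rfl⟩, by simp, ?_⟩
    classical
    rw [MonomialOrder.degree_monomial, if_neg one_ne_zero]
  · have := hW.finite d
    rw [← finrank_eq_finrank_span_leadingExponents (W d)]
    have : degreePart (Ideal.span ((fun a => monomial a (1 : K)) '' E)) d =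
        Submodule.span K ((fun a => monomial a (1 : K)) '' leadingExponents (W d)) := by
      refine le_antisymm (fun f hf => mem_span_monomial fun a ha => ?_) (Submodule.span_le.2 ?_)
      · obtain ⟨s, hs, hsa⟩ := mem_ideal_span_monomial_image.1 hf.1 a ha
        obtain ⟨b, rfl⟩ := exists_add_of_le hsa
        obtain ⟨k, hk⟩ := hstep s hs b
        have h1 := hdeg k _ hk
        have h2 : (s + b).degree = d := by
          by_contra h
          exact mem_support_iff.1 ha (hf.2.coeff_eq_zero h)
        rwa [← h2, h1]
      · rintro _ ⟨a, ha, rfl⟩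
        exact ⟨Ideal.subset_span ⟨a, ⟨d, ha⟩, rfl⟩, isHomogeneous_monomial _ (hdeg d a ha)⟩
    rw [this]

end MonomialIdeals

/-! ### Distractions as graded linear bijections -/

section Distractions

variable {K : Type*} [Field K] {n : ℕ}

theorem restrictScalars_span_of_X_mul_mem {S : Set (MvPolynomial (Fin n) K)}
    (hS : ∀ i, ∀ f ∈ S, X i * f ∈ Submodule.span K S) :
    (Ideal.span S).restrictScalars K = Submodule.span K S := by
  refine le_antisymm (fun f hf => ?_) (Submodule.span_le.2 Ideal.subset_span)
  have hX : ∀ i, ∀ f ∈ Submodule.span K S, X i * f ∈ Submodule.span K S := by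
    intro i f hf
    induction hf using Submodule.span_induction with
    | mem x hx => exact hS i x hx
    | zero => simp
    | add x y _ _ hx hy =>
      rw [mul_add]
      exact add_mem hx hy
    | smul a x _ hx =>
      rw [mul_smul_comm]
      exact Submodule.smul_mem _ a hx
  refine Submodule.span_induction (p := fun f _ => f ∈ Submodule.span K S)
    (fun x hx => Submodule.subset_span hx) (zero_mem _) (fun x y _ _ hx hy => add_mem hx hy)
    (fun g x _ hx => ?_) hf
  rw [smul_eq_mul]
  induction g using MvPolynomial.induction_on with
  | C a =>
    rw [← smul_eq_C_mul]
    exact Submodule.smul_mem _ a hx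
  | add p q hp hq =>
    rw [add_mul]
    exact add_mem hp hq
  | mul_X p i hp =>
    rw [mul_comm p, mul_assoc]
    exact hX i _ hp

namespace Distraction

variable (D : Distraction K n)

theorem onMonomial_isHomogeneous (a : Fin n →₀ ℕ) : (D.onMonomial a).IsHomogeneous a.degree := by
  rw [Finsupp.degree_eq_sum]
  refine IsHomogeneous.prod _ _ _ fun i _ => ?_
  have := IsHomogeneous.prod (Finset.range (a i)) (D.entry i) (fun _ => 1)
    fun j _ => D.mem_linear i j
  simpa using this

/-- Columns are numbered from `0`, so `D.entry i (a i)` is the first entry of row `i` not yet used.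
-/
theorem entry_mul_onMonomial (a : Fin n →₀ ℕ) (i : Fin n) :
    D.entry i (a i) * D.onMonomial a = D.onMonomial (a + Finsupp.single i 1) := by
  classical
  rw [onMonomial, onMonomial, ← Finset.mul_prod_erase _ _ (Finset.mem_univ i),
    ← Finset.mul_prod_erase _ _ (Finset.mem_univ i), ← mul_assoc]
  congr 1
  · simp [Finset.prod_range_succ, mul_comm]
  · refine Finset.prod_congr rfl fun k hk => ?_
    simp [Finsupp.single_eq_of_ne (Finset.ne_of_mem_erase hk)]

/-- The next unused entries, one per row, span the linear forms, so `X i` is a combination of them,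
and each raises one exponent of `a`. Hence linear spans of distractions over upward closed sets are
already ideals. -/
theorem X_mul_onMonomial_mem {E : Set (Fin n →₀ ℕ)}
    (hE : ∀ a ∈ E, ∀ i, a + Finsupp.single i 1 ∈ E) (i : Fin n) {a : Fin n →₀ ℕ} (ha : a ∈ E) :
    X i * D.onMonomial a ∈ Submodule.span K (D.onMonomial '' E) := by
  have hX : (X i : MvPolynomial (Fin n) K) ∈
      Submodule.span K (Set.range fun k => D.entry k (a k)) := by
    rw [D.span_eq]
    exact isHomogeneous_X K i
  generalize (X i : MvPolynomial (Fin n) K) = x at hX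
  induction hX using Submodule.span_induction with
  | mem x hx =>
    obtain ⟨k, rfl⟩ := hx
    dsimp only
    rw [entry_mul_onMonomial]
    exact Submodule.subset_span ⟨_, hE a ha k, rfl⟩
  | zero => simp
  | add x y _ _ hx hy =>
    rw [add_mul]
    exact add_mem hx hy
  | smul r x _ hx =>
    rw [smul_mul_assoc]
    exact Submodule.smul_mem _ r hx

theorem restrictScalars_span {E : Set (Fin n →₀ ℕ)}
    (hE : ∀ a ∈ E, ∀ i, a + Finsupp.single i 1 ∈ E) :
    (Ideal.span (D.onMonomial '' E)).restrictScalars K =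
      Submodule.span K (D.onMonomial '' E) := by
  refine restrictScalars_span_of_X_mul_mem ?_
  rintro i _ ⟨a, ha, rfl⟩
  exact D.X_mul_onMonomial_mem hE i ha

/-- The linear map sending each monomial to its distraction. -/
def toLinearMap : MvPolynomial (Fin n) K →ₗ[K] MvPolynomial (Fin n) K :=
  (basisMonomials (Fin n) K).constr K D.onMonomial

theorem toLinearMap_monomial (a : Fin n →₀ ℕ) :
    D.toLinearMap (monomial a 1) = D.onMonomial a :=
  (basisMonomials (Fin n) K).constr_basis K D.onMonomial a

theorem map_toLinearMap_span (E : Set (Fin n →₀ ℕ)) :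
    (Submodule.span K ((fun a => monomial a (1 : K)) '' E)).map D.toLinearMap =
      Submodule.span K (D.onMonomial '' E) := by
  rw [Submodule.map_span, Set.image_image]
  simp only [toLinearMap_monomial]

theorem homogeneousComponent_toLinearMap (d : ℕ) (f : MvPolynomial (Fin n) K) :
    homogeneousComponent d (D.toLinearMap f) = D.toLinearMap (homogeneousComponent d f) := by
  have : (homogeneousComponent d).comp D.toLinearMap =
      D.toLinearMap.comp (homogeneousComponent d) := by
    refine (basisMonomials (Fin n) K).ext fun a => ?_
    simp only [coe_basisMonomials, LinearMap.comp_apply, toLinearMap_monomial]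
    rw [homogeneousComponent_of_mem (D.onMonomial_isHomogeneous a),
      homogeneousComponent_of_mem (isHomogeneous_monomial (1 : K) rfl)]
    split_ifs <;> simp [toLinearMap_monomial]
  exact LinearMap.congr_fun this f

/-- The span of all distracted monomials is an ideal, and it contains the distraction of `1`. -/
theorem toLinearMap_surjective : Function.Surjective D.toLinearMap := by
  intro f
  have h1 := D.restrictScalars_span (E := Set.univ) fun a _ i => Set.mem_univ _
  have h2 : Ideal.span (D.onMonomial '' Set.univ) = ⊤ := by
    refine (Ideal.eq_top_iff_one _).2 (Ideal.subset_span ⟨0, Set.mem_univ _, ?_⟩)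
    simp [onMonomial]
  have h3 : f ∈ Submodule.span K (D.onMonomial '' Set.univ) := by
    rw [← h1, h2]
    trivial
  rw [← map_toLinearMap_span] at h3
  obtain ⟨g, -, hg⟩ := h3
  exact ⟨g, hg⟩

theorem toLinearMap_mem_homogeneousSubmodule {d : ℕ} {f : MvPolynomial (Fin n) K}
    (hf : f ∈ homogeneousSubmodule (Fin n) K d) :
    D.toLinearMap f ∈ homogeneousSubmodule (Fin n) K d := by
  rw [← homogeneousComponent_eq_self hf, ← homogeneousComponent_toLinearMap]
  exact homogeneousComponent_mem _ _

theorem map_toLinearMap_homogeneousSubmodule (d : ℕ) :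
    (homogeneousSubmodule (Fin n) K d).map D.toLinearMap = homogeneousSubmodule (Fin n) K d := by
  refine le_antisymm ?_ fun f hf => ?_
  · rintro _ ⟨f, hf, rfl⟩
    exact D.toLinearMap_mem_homogeneousSubmodule hf
  · obtain ⟨g, rfl⟩ := D.toLinearMap_surjective f
    refine ⟨homogeneousComponent d g, homogeneousComponent_mem d g, ?_⟩
    rw [← homogeneousComponent_toLinearMap, homogeneousComponent_eq_self hf]

/-- In each degree the map is a surjective endomorphism of a finite-dimensional space. -/
theorem toLinearMap_injective : Function.Injective D.toLinearMap := by
  rw [injective_iff_map_eq_zero]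
  intro f hf
  rw [← sum_homogeneousComponent f]
  refine Finset.sum_eq_zero fun d _ => ?_
  let φ : homogeneousSubmodule (Fin n) K d →ₗ[K] homogeneousSubmodule (Fin n) K d :=
    D.toLinearMap.restrict fun f hf => D.toLinearMap_mem_homogeneousSubmodule hf
  have hφ : Function.Surjective φ := by
    rintro ⟨f, hf⟩
    rw [← D.map_toLinearMap_homogeneousSubmodule d] at hf
    obtain ⟨g, hg, hgf⟩ := hf
    exact ⟨⟨g, hg⟩, Subtype.ext hgf⟩
  have hinj : Function.Injective φ := LinearMap.injective_iff_surjective.2 hφ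
  have h0 : φ ⟨_, homogeneousComponent_mem d f⟩ = 0 := by
    refine Subtype.ext ?_
    change D.toLinearMap (homogeneousComponent d f) = 0
    rw [← homogeneousComponent_toLinearMap, hf, map_zero]
  exact congrArg Subtype.val ((injective_iff_map_eq_zero φ).1 hinj _ h0)

theorem onIdeal_mono {I J : Ideal (MvPolynomial (Fin n) K)} (h : I ≤ J) :
    D.onIdeal I ≤ D.onIdeal J :=
  Ideal.span_mono (Set.image_mono fun _ ha => h ha)

theorem homogeneousComponent_mem_onIdeal (I : Ideal (MvPolynomial (Fin n) K)) :
    ∀ f ∈ D.onIdeal I, ∀ d, homogeneousComponent d f ∈ D.onIdeal I := by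
  intro f hf d
  refine homogeneousComponent_mem_span ?_ hf d
  rintro _ ⟨a, -, rfl⟩
  exact ⟨_, D.onMonomial_isHomogeneous a⟩

theorem restrictScalars_onIdeal {M : Ideal (MvPolynomial (Fin n) K)} (hM : IsMonomialIdeal M) :
    (D.onIdeal M).restrictScalars K = (M.restrictScalars K).map D.toLinearMap := by
  rw [hM.restrictScalars_eq_span, map_toLinearMap_span, onIdeal, restrictScalars_span]
  intro a ha i
  have : monomial (a + Finsupp.single i 1) (1 : K) = X i * monomial a 1 := by
    rw [X, monomial_mul, one_mul, add_comm]
  change monomial (a + Finsupp.single i 1) (1 : K) ∈ M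
  rw [this]
  exact M.mul_mem_left _ ha

theorem finrank_degreePart_onIdeal {M : Ideal (MvPolynomial (Fin n) K)} (hM : IsMonomialIdeal M)
    (d : ℕ) : Module.finrank K (degreePart (D.onIdeal M) d) = Module.finrank K (degreePart M d) := by
  have : degreePart (D.onIdeal M) d = (degreePart M d).map D.toLinearMap := by
    rw [degreePart, degreePart, Submodule.map_inf _ D.toLinearMap_injective,
      map_toLinearMap_homogeneousSubmodule, restrictScalars_onIdeal D hM]
  rw [this]
  exact (Submodule.equivMapOfInjective _ D.toLinearMap_injective _).finrank_eq.symm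

/-- The Hilbert functions of a quotient by a monomial ideal and of the quotient by its distraction
agree as soon as the dimensions of graded families above the two ideals do. -/
theorem mem_hilbertPoset_onIdeal {c : Ideal (MvPolynomial (Fin n) K)} (hc : IsMonomialIdeal c)
    {H : ℕ → ℕ} :
    H ∈ hilbertPoset (quotGrading (D.onIdeal c)) ↔
      ∃ W, IsGradedFamily W ∧ (∀ d, degreePart (D.onIdeal c) d ≤ W d) ∧
        ∀ d, H d + Module.finrank K (degreePart c d) = Module.finrank K (W d) := by
  rw [mem_hilbertPoset_quotGrading (D.homogeneousComponent_mem_onIdeal c)]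
  simp only [D.finrank_degreePart_onIdeal hc]

/-- Replace a family above `c` by an initial ideal, which still contains the monomial ideal `c`, and
distract that. -/
theorem hilbertPoset_subset_onIdeal {c : Ideal (MvPolynomial (Fin n) K)}
    (hc : IsMonomialIdeal c) :
    hilbertPoset (quotGrading c) ⊆ hilbertPoset (quotGrading (D.onIdeal c)) := by
  intro H hH
  obtain ⟨W, hW, hcW, hHW⟩ := (mem_hilbertPoset_quotGrading hc.homogeneousComponent_mem).1 hH
  obtain ⟨M, hM, hcM, hMW⟩ := hW.exists_isMonomialIdeal hc hcW
  refine (D.mem_hilbertPoset_onIdeal hc).2 ⟨degreePart (D.onIdeal M),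
    degreePart_isGradedFamily _, degreePart_mono (D.onIdeal_mono hcM), fun d => ?_⟩
  rw [D.finrank_degreePart_onIdeal hM, hMW, hHW]

end Distraction

end Distractions

/-! ### Adjoining a variable: extended ideals, linear sections and colon ideals -/

section OneMoreVariable

variable {K : Type*} [Field K] {m : ℕ}

theorem powIdeal_top {R : Type*} [CommRing R] (x : R) : powIdeal x ⊤ = ⊥ := rfl

theorem powIdeal_natCast {R : Type*} [CommRing R] (x : R) (e : ℕ) :
    powIdeal x (e : ℕ∞) = Ideal.span {x ^ e} := rfl

theorem extendIdeal_isMonomialIdeal {I : Ideal (MvPolynomial (Fin m) K)} (hI : IsMonomialIdeal I)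
    (e : ℕ∞) : IsMonomialIdeal (extendIdeal I e) := by
  obtain ⟨S, rfl⟩ := hI
  have h1 : (Ideal.span ((fun s => monomial s (1 : K)) '' S)).map
      (rename (R := K) (Fin.castSucc (n := m))) =
      Ideal.span ((fun s => monomial s (1 : K)) '' (Finsupp.mapDomain Fin.castSucc '' S)) := by
    rw [Ideal.map_span, Set.image_image, Set.image_image]
    simp only [rename_monomial]
  induction e using ENat.recTopCoe with
  | top => exact ⟨_, by rw [extendIdeal, powIdeal_top, sup_bot_eq, h1]⟩
  | coe e =>
    refine ⟨Finsupp.mapDomain Fin.castSucc '' S ∪ {Finsupp.single (Fin.last m) e}, ?_⟩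
    rw [extendIdeal, powIdeal_natCast, h1, Set.image_union, Ideal.span_union,
      Set.image_singleton, X_pow_eq_monomial]

theorem monomial_mapDomain_mem_extendIdeal {I : Ideal (MvPolynomial (Fin m) K)} (e : ℕ∞)
    {a : Fin m →₀ ℕ} (ha : monomial a (1 : K) ∈ I) :
    monomial (a.mapDomain Fin.castSucc) (1 : K) ∈ extendIdeal I e := by
  have := Ideal.mem_map_of_mem (rename (R := K) (Fin.castSucc (n := m))) ha
  rw [rename_monomial] at this
  exact Ideal.mem_sup_left this

theorem monomial_single_last_mem_extendIdeal (I : Ideal (MvPolynomial (Fin m) K)) (e : ℕ) :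
    monomial (Finsupp.single (Fin.last m) e) (1 : K) ∈ extendIdeal I e := by
  refine Ideal.mem_sup_right ?_
  rw [powIdeal_natCast, ← X_pow_eq_monomial]
  exact Ideal.mem_span_singleton_self _

variable (K m) in
/-- The substitution `X_{m+1} = 0`. -/
def killLast : MvPolynomial (Fin (m + 1)) K →ₐ[K] MvPolynomial (Fin m) K :=
  aeval (Fin.snoc (α := fun _ => MvPolynomial (Fin m) K) X 0)

@[simp]
theorem killLast_X_last : killLast K m (X (Fin.last m)) = 0 := by
  simp [killLast]

@[simp]
theorem killLast_X_castSucc (i : Fin m) : killLast K m (X i.castSucc) = X i := by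
  simp [killLast]

@[simp]
theorem killLast_rename (f : MvPolynomial (Fin m) K) :
    killLast K m (rename Fin.castSucc f) = f := by
  have : (killLast K m).comp (rename Fin.castSucc) = AlgHom.id K _ := by
    ext i
    simp
  exact AlgHom.congr_fun this f

theorem killLast_eq_zero_iff {f : MvPolynomial (Fin (m + 1)) K} :
    killLast K m f = 0 ↔ X (Fin.last m) ∣ f := by
  constructor
  · intro hf
    have h : Ideal.Quotient.mkₐ K (Ideal.span {(X (Fin.last m) : MvPolynomial (Fin (m + 1)) K)}) =
        ((Ideal.Quotient.mkₐ K _).comp (rename Fin.castSucc)).comp (killLast K m) := by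
      refine algHom_ext fun i => ?_
      induction i using Fin.lastCases with
      | last =>
        rw [AlgHom.comp_apply, killLast_X_last, map_zero, Ideal.Quotient.mkₐ_eq_mk]
        exact Ideal.Quotient.eq_zero_iff_mem.2 (Ideal.mem_span_singleton_self _)
      | cast i => simp
    have h1 := AlgHom.congr_fun h f
    rw [AlgHom.comp_apply, hf, map_zero, Ideal.Quotient.mkₐ_eq_mk,
      Ideal.Quotient.eq_zero_iff_mem] at h1
    exact Ideal.mem_span_singleton.1 h1
  · rintro ⟨g, rfl⟩
    simp

theorem killLast_mem_homogeneousSubmodule {d : ℕ} {f : MvPolynomial (Fin (m + 1)) K}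
    (hf : f.IsHomogeneous d) : (killLast K m f).IsHomogeneous d := by
  have := hf.aeval (Fin.snoc (α := fun _ => MvPolynomial (Fin m) K) X 0) (n := 1) fun i => by
    induction i using Fin.lastCases with
    | last => simpa using isHomogeneous_zero (Fin m) K 1
    | cast i => simpa using isHomogeneous_X K i
  rwa [one_mul] at this

/-- A graded surjection of polynomial rings whose kernel is generated by the linear form `l`. -/
structure LinearProjection (l : MvPolynomial (Fin (m + 1)) K) where
  toAlgHom : MvPolynomial (Fin (m + 1)) K →ₐ[K] MvPolynomial (Fin m) K
  isHomogeneous : l.IsHomogeneous 1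
  ne_zero : l ≠ 0
  map_eq : ∀ d, (homogeneousSubmodule (Fin (m + 1)) K d).map toAlgHom.toLinearMap =
    homogeneousSubmodule (Fin m) K d
  eq_zero_iff : ∀ f, toAlgHom f = 0 ↔ l ∣ f

/-- The entries of one column choice are linear coordinates, so substituting them for the variables
is an automorphism. Undo it, then set the last variable to zero. -/
theorem Distraction.nonempty_linearProjection (D : Distraction K (m + 1)) (j : ℕ) :
    Nonempty (LinearProjection (D.entry (Fin.last m) j)) := by
  let c : Fin (m + 1) → ℕ := Function.update 0 (Fin.last m) j
  -- With constant rows, distraction is substitution, so bijectivity comes from the general case.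
  let D' : Distraction K (m + 1) :=
    { entry := fun i _ => D.entry i (c i)
      mem_linear := fun i _ => D.mem_linear i _
      span_eq := fun _ => D.span_eq c
      eventually_const := ⟨0, fun _ _ _ => rfl⟩ }
  let φ : MvPolynomial (Fin (m + 1)) K →ₐ[K] MvPolynomial (Fin (m + 1)) K :=
    aeval fun i => D.entry i (c i)
  have hφ : φ.toLinearMap = D'.toLinearMap := by
    refine (basisMonomials (Fin (m + 1)) K).ext fun a => ?_
    simp only [coe_basisMonomials, D'.toLinearMap_monomial, AlgHom.toLinearMap_apply, φ,
      aeval_monomial, map_one, one_mul]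
    rw [Finsupp.prod_fintype _ _ fun i => pow_zero _]
    simp [Distraction.onMonomial, D']
  have hφ' : ∀ f, φ f = D'.toLinearMap f := LinearMap.congr_fun hφ
  have hbij : Function.Bijective φ := by
    have : (φ : _ → _) = D'.toLinearMap := funext hφ'
    rw [this]
    exact ⟨D'.toLinearMap_injective, D'.toLinearMap_surjective⟩
  let ψ := AlgEquiv.ofBijective φ hbij
  have hψ : ∀ f, ψ f = φ f := fun _ => rfl
  have hl : φ (X (Fin.last m)) = D.entry (Fin.last m) j := by simp [φ, c]
  refine ⟨⟨(killLast K m).comp ψ.symm.toAlgHom, D.mem_linear _ _, ?_, fun d => ?_, fun f => ?_⟩⟩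
  · rw [← hl]
    exact (map_ne_zero_iff φ hbij.1).2 (X_ne_zero _)
  · refine le_antisymm ?_ fun f hf => ?_
    · rintro _ ⟨f, hf, rfl⟩
      rw [← D'.map_toLinearMap_homogeneousSubmodule d] at hf
      obtain ⟨g, hg, rfl⟩ := hf
      have : ψ.symm (D'.toLinearMap g) = g := by
        rw [← hφ', ← hψ, AlgEquiv.symm_apply_apply]
      change killLast K m (ψ.symm (D'.toLinearMap g)) ∈ _
      rw [this]
      exact killLast_mem_homogeneousSubmodule hg
    · refine ⟨ψ (rename Fin.castSucc f), ?_, ?_⟩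
      · rw [hψ, hφ']
        exact D'.toLinearMap_mem_homogeneousSubmodule (hf.rename_isHomogeneous)
      · change killLast K m (ψ.symm (ψ (rename Fin.castSucc f))) = f
        rw [AlgEquiv.symm_apply_apply, killLast_rename]
  · change killLast K m (ψ.symm f) = 0 ↔ _
    rw [killLast_eq_zero_iff, ← hl, ← hψ, ← map_dvd_iff ψ, AlgEquiv.apply_symm_apply]

/-- The colon ideal `(J : l)`. -/
def colonElement (J : Ideal (MvPolynomial (Fin m) K)) (l : MvPolynomial (Fin m) K) :
    Ideal (MvPolynomial (Fin m) K) :=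
  Submodule.comap (LinearMap.mulLeft (MvPolynomial (Fin m) K) l) J

theorem mem_colonElement {J : Ideal (MvPolynomial (Fin m) K)} {l f : MvPolynomial (Fin m) K} :
    f ∈ colonElement J l ↔ l * f ∈ J :=
  Iff.rfl

theorem le_colonElement (J : Ideal (MvPolynomial (Fin m) K)) (l : MvPolynomial (Fin m) K) :
    J ≤ colonElement J l :=
  fun _ hf => J.mul_mem_left l hf

namespace LinearProjection

variable {l : MvPolynomial (Fin (m + 1)) K} (π : LinearProjection l)

/-- The graded pieces of the image of `J` under the projection. -/
def image (J : Ideal (MvPolynomial (Fin (m + 1)) K)) (d : ℕ) :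
    Submodule K (MvPolynomial (Fin m) K) :=
  (degreePart J d).map π.toAlgHom.toLinearMap

theorem image_mono {I J : Ideal (MvPolynomial (Fin (m + 1)) K)} (h : I ≤ J) (d : ℕ) :
    π.image I d ≤ π.image J d :=
  Submodule.map_mono (degreePart_mono h d)

theorem image_isGradedFamily (J : Ideal (MvPolynomial (Fin (m + 1)) K)) :
    IsGradedFamily (π.image J) where
  le d := by
    rw [← π.map_eq d]
    exact Submodule.map_mono inf_le_right
  X_mul_mem d i f hf := by
    obtain ⟨g, hg, rfl⟩ := hf
    have hX : (X i : MvPolynomial (Fin m) K) ∈ homogeneousSubmodule (Fin m) K 1 :=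
      isHomogeneous_X K i
    rw [← π.map_eq 1] at hX
    obtain ⟨x, hx, hxi⟩ := hX
    refine ⟨x * g, (degreePart_isGradedFamily J).linear_mul_mem hx hg, ?_⟩
    rw [← hxi]
    exact map_mul π.toAlgHom x g

/-- The kernel of the projection on the degree `d + 1` part of `J` is `l` times the degree `d` part
of `(J : l)`. -/
theorem finrank_image_succ (J : Ideal (MvPolynomial (Fin (m + 1)) K)) (d : ℕ) :
    Module.finrank K (π.image J (d + 1)) + Module.finrank K (degreePart (colonElement J l) d) =
      Module.finrank K (degreePart J (d + 1)) := by
  have := (degreePart_isGradedFamily J).finite (d + 1)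
  rw [← finrank_map_add_finrank_of_ker π.toAlgHom.toLinearMap (degreePart J (d + 1)), image]
  congr 1
  have hinj : Function.Injective (LinearMap.mulLeft K l) := mul_right_injective₀ π.ne_zero
  have h : degreePart J (d + 1) ⊓ LinearMap.ker π.toAlgHom.toLinearMap =
      (degreePart (colonElement J l) d).map (LinearMap.mulLeft K l) := by
    refine le_antisymm (fun f hf => ?_) ?_
    · obtain ⟨g, rfl⟩ := (π.eq_zero_iff f).1 hf.2
      have hg : l * g = l * homogeneousComponent d g := by
        rw [← homogeneousComponent_linear_mul π.isHomogeneous,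
          homogeneousComponent_eq_self hf.1.2]
      refine ⟨homogeneousComponent d g, ⟨?_, homogeneousComponent_mem d g⟩, hg.symm⟩
      change l * homogeneousComponent d g ∈ J
      rw [← hg]
      exact hf.1.1
    · rintro _ ⟨g, hg, rfl⟩
      exact ⟨⟨hg.1, isHomogeneous_mul_left π.isHomogeneous hg.2⟩,
        (π.eq_zero_iff _).2 (dvd_mul_right l g)⟩
  rw [h]
  exact (Submodule.equivMapOfInjective _ hinj _).finrank_eq

theorem finrank_image_zero (J : Ideal (MvPolynomial (Fin (m + 1)) K)) :
    Module.finrank K (π.image J 0) = Module.finrank K (degreePart J 0) := by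
  have := (degreePart_isGradedFamily J).finite 0
  rw [← finrank_map_add_finrank_of_ker π.toAlgHom.toLinearMap (degreePart J 0), image]
  have h : degreePart J 0 ⊓ LinearMap.ker π.toAlgHom.toLinearMap = ⊥ := by
    refine (Submodule.eq_bot_iff _).2 fun f hf => ?_
    obtain ⟨g, rfl⟩ := (π.eq_zero_iff f).1 hf.2
    rw [← homogeneousComponent_eq_self hf.1.2,
      homogeneousComponent_zero_linear_mul π.isHomogeneous]
  rw [h, finrank_bot, add_zero]

end LinearProjection

/-- The distraction of the smaller polynomial ring obtained by reducing the first rows of a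
distraction modulo an entry of the last row. -/
def Distraction.restrict (D : Distraction K (m + 1)) {j : ℕ}
    (π : LinearProjection (D.entry (Fin.last m) j)) : Distraction K m where
  entry i k := π.toAlgHom (D.entry i.castSucc k)
  mem_linear i k := by
    rw [← π.map_eq 1]
    exact ⟨_, D.mem_linear _ _, rfl⟩
  span_eq c := by
    refine le_antisymm (Submodule.span_le.2 ?_) ?_
    · rintro _ ⟨i, rfl⟩
      rw [← π.map_eq 1]
      exact ⟨_, D.mem_linear _ _, rfl⟩
    -- Complete `c` by column `j` in the last row; the added entry dies under the projection, so the
    -- other images span.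
    · rw [← π.map_eq 1, ← D.span_eq (Fin.snoc (α := fun _ => ℕ) c j), Submodule.map_span,
        Submodule.span_le]
      rintro _ ⟨_, ⟨i, rfl⟩, rfl⟩
      induction i using Fin.lastCases with
      | last =>
        have : π.toAlgHom (D.entry (Fin.last m) j) = 0 := (π.eq_zero_iff _).2 dvd_rfl
        simp [this]
      | cast i =>
        refine Submodule.subset_span ⟨i, ?_⟩
        simp
  eventually_const := by
    obtain ⟨N, hN⟩ := D.eventually_const
    exact ⟨N, fun i k hk => by rw [hN _ _ hk]⟩

theorem Distraction.restrict_onMonomial (D : Distraction K (m + 1)) {j : ℕ}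
    (π : LinearProjection (D.entry (Fin.last m) j)) (a : Fin m →₀ ℕ) :
    (D.restrict π).onMonomial a = π.toAlgHom (D.onMonomial (a.mapDomain Fin.castSucc)) := by
  have hlast : a.mapDomain Fin.castSucc (Fin.last m) = 0 :=
    Finsupp.mapDomain_of_notMem_range _ _ fun ⟨i, hi⟩ => Fin.castSucc_ne_last i hi
  simp only [onMonomial, Fin.prod_univ_castSucc, hlast, Finset.range_zero, Finset.prod_empty,
    mul_one, map_prod, Finsupp.mapDomain_apply (Fin.castSucc_injective m)]
  rfl

theorem Distraction.onIdeal_restrict_le_image (D : Distraction K (m + 1)) {j : ℕ}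
    (π : LinearProjection (D.entry (Fin.last m) j)) {I : Ideal (MvPolynomial (Fin m) K)}
    {J : Ideal (MvPolynomial (Fin (m + 1)) K)}
    (hJ : ∀ a, monomial a (1 : K) ∈ I → D.onMonomial (a.mapDomain Fin.castSucc) ∈ J) (d : ℕ) :
    degreePart ((D.restrict π).onIdeal I) d ≤ π.image J d := by
  have hfam := π.image_isGradedFamily J
  rw [← hfam.degreePart_toIdeal]
  refine degreePart_mono (Ideal.span_le.2 ?_) d
  rintro _ ⟨a, ha, rfl⟩
  rw [D.restrict_onMonomial]
  exact hfam.mem_toIdeal_of_mem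
    (Submodule.mem_map_of_mem ⟨hJ a ha, D.onMonomial_isHomogeneous _⟩)

/-! ### Assembling slices along powers of the last variable -/

section Stack

/-- The degree `d` part of `⨁ i, L i * X_{m+1} ^ i`. -/
def stack : (ℕ → ℕ → Submodule K (MvPolynomial (Fin m) K)) → ℕ →
    Submodule K (MvPolynomial (Fin (m + 1)) K)
  | L, 0 => (L 0 0).map (rename Fin.castSucc).toLinearMap
  | L, d + 1 => (L 0 (d + 1)).map (rename Fin.castSucc).toLinearMap ⊔
      (stack (fun i => L (i + 1)) d).map (LinearMap.mulLeft K (X (Fin.last m)))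

variable {L L' : ℕ → ℕ → Submodule K (MvPolynomial (Fin m) K)}

theorem map_rename_le_stack (d : ℕ) :
    (L 0 d).map (rename Fin.castSucc).toLinearMap ≤ stack L d := by
  cases d with
  | zero => exact le_rfl
  | succ d => exact le_sup_left

theorem stack_le (hL : ∀ i d, L i d ≤ homogeneousSubmodule (Fin m) K d) (d : ℕ) :
    stack L d ≤ homogeneousSubmodule (Fin (m + 1)) K d := by
  have h0 : ∀ (L : ℕ → ℕ → Submodule K (MvPolynomial (Fin m) K)),
      (∀ i d, L i d ≤ homogeneousSubmodule (Fin m) K d) → ∀ d,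
      (L 0 d).map (rename Fin.castSucc).toLinearMap ≤ homogeneousSubmodule (Fin (m + 1)) K d := by
    rintro L hL d _ ⟨f, hf, rfl⟩
    exact IsHomogeneous.rename_isHomogeneous (hL 0 d hf)
  induction d generalizing L with
  | zero => exact h0 L hL 0
  | succ d ih =>
    refine sup_le (h0 L hL _) ?_
    rintro _ ⟨f, hf, rfl⟩
    exact isHomogeneous_mul_left (isHomogeneous_X K _) (ih (fun i => hL (i + 1)) hf)

theorem stack_mono {d : ℕ} (h : ∀ i ≤ d, L i (d - i) ≤ L' i (d - i)) :
    stack L d ≤ stack L' d := by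
  induction d generalizing L L' with
  | zero => exact Submodule.map_mono (h 0 le_rfl)
  | succ d ih =>
    refine sup_le_sup (Submodule.map_mono (h 0 (Nat.zero_le _))) (Submodule.map_mono (ih ?_))
    intro i hi
    have := h (i + 1) (by omega)
    rwa [Nat.add_sub_add_right] at this

theorem X_castSucc_mul_mem_stack (hL : ∀ i, IsGradedFamily (L i)) {d : ℕ} (k : Fin m)
    {f : MvPolynomial (Fin (m + 1)) K} (hf : f ∈ stack L d) :
    X k.castSucc * f ∈ stack L (d + 1) := by
  have h0 : ∀ (L : ℕ → ℕ → Submodule K (MvPolynomial (Fin m) K)),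
      (∀ i, IsGradedFamily (L i)) → ∀ d f, f ∈ (L 0 d).map (rename Fin.castSucc).toLinearMap →
      X k.castSucc * f ∈ stack L (d + 1) := by
    rintro L hL d _ ⟨g, hg, rfl⟩
    refine map_rename_le_stack (d + 1) ⟨X k * g, (hL 0).X_mul_mem d k g hg, ?_⟩
    simp
  induction d generalizing L f with
  | zero => exact h0 L hL 0 f hf
  | succ d ih =>
    obtain ⟨p, hp, _, ⟨q, hq, rfl⟩, rfl⟩ := Submodule.mem_sup.1 hf
    rw [mul_add]
    refine add_mem (h0 L hL _ p hp) (Submodule.mem_sup_right ⟨_, ih (fun i => hL (i + 1)) hq, ?_⟩)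
    simp only [LinearMap.mulLeft_apply]
    ring

/-- Multiplication shifts slice `i` to slice `i + 1` but keeps its degree `d - i`, so inclusions are
needed only in those degrees. That is all the choice of slices will provide. -/
theorem X_last_mul_mem_stack {d : ℕ} (h : ∀ i ≤ d, L i (d - i) ≤ L (i + 1) (d - i))
    {f : MvPolynomial (Fin (m + 1)) K} (hf : f ∈ stack L d) :
    X (Fin.last m) * f ∈ stack L (d + 1) :=
  Submodule.mem_sup_right ⟨f, stack_mono (L' := fun i => L (i + 1)) h hf, rfl⟩

theorem X_mul_mem_stack (hL : ∀ i, IsGradedFamily (L i)) {d : ℕ}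
    (h : ∀ i ≤ d, L i (d - i) ≤ L (i + 1) (d - i)) (k : Fin (m + 1))
    {f : MvPolynomial (Fin (m + 1)) K} (hf : f ∈ stack L d) : X k * f ∈ stack L (d + 1) := by
  induction k using Fin.lastCases with
  | last => exact X_last_mul_mem_stack h hf
  | cast k => exact X_castSucc_mul_mem_stack hL k hf

theorem stack_isGradedFamily (hL : ∀ i, IsGradedFamily (L i)) (h : ∀ i d, L i d ≤ L (i + 1) d) :
    IsGradedFamily (stack L) where
  le := stack_le fun i => (hL i).le
  X_mul_mem _ k _ hf := X_mul_mem_stack hL (fun i _ => h i _) k hf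

theorem X_last_pow_mem_stack {e : ℕ} (h : 1 ∈ L e 0) :
    (X (Fin.last m) : MvPolynomial (Fin (m + 1)) K) ^ e ∈ stack L e := by
  induction e generalizing L with
  | zero => exact ⟨1, h, by simp⟩
  | succ e ih =>
    rw [pow_succ']
    exact Submodule.mem_sup_right ⟨_, ih (L := fun i => L (i + 1)) h, rfl⟩

theorem finrank_map_rename (V : Submodule K (MvPolynomial (Fin m) K)) :
    Module.finrank K (V.map (rename (R := K) (Fin.castSucc (n := m))).toLinearMap) =
      Module.finrank K V :=
  (Submodule.equivMapOfInjective (rename (R := K) (Fin.castSucc (n := m))).toLinearMap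
    (rename_injective _ (Fin.castSucc_injective m)) V).finrank_eq.symm

theorem finrank_stack_zero : Module.finrank K (stack L 0) = Module.finrank K (L 0 0) :=
  finrank_map_rename _

theorem finrank_stack_succ (hL : ∀ i d, L i d ≤ homogeneousSubmodule (Fin m) K d) (d : ℕ) :
    Module.finrank K (stack L (d + 1)) =
      Module.finrank K (L 0 (d + 1)) + Module.finrank K (stack (fun i => L (i + 1)) d) := by
  have := finite_of_le_homogeneousSubmodule (hL 0 (d + 1))
  have := finite_of_le_homogeneousSubmodule (stack_le (fun i => hL (i + 1)) d)
  have hinj : Function.Injective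
      (LinearMap.mulLeft K (X (Fin.last m) : MvPolynomial (Fin (m + 1)) K)) :=
    mul_right_injective₀ (X_ne_zero _)
  rw [stack, ← finrank_map_rename (L 0 (d + 1)),
    (Submodule.equivMapOfInjective _ hinj (stack (fun i => L (i + 1)) d)).finrank_eq,
    ← Submodule.finrank_sup_add_finrank_inf_eq]
  have h : (L 0 (d + 1)).map (rename Fin.castSucc).toLinearMap ⊓
      (stack (fun i => L (i + 1)) d).map (LinearMap.mulLeft K (X (Fin.last m))) = ⊥ := by
    refine (Submodule.eq_bot_iff _).2 ?_
    rintro _ ⟨⟨f, hf, rfl⟩, ⟨g, hg, hfg⟩⟩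
    have := congrArg (killLast K m) hfg
    simp only [LinearMap.mulLeft_apply, map_mul, killLast_X_last, zero_mul,
      AlgHom.toLinearMap_apply, killLast_rename] at this
    rw [← this, map_zero]
  rw [h, finrank_bot, add_zero]

theorem stack_homogeneousSubmodule :
    stack (fun _ => homogeneousSubmodule (Fin m) K) = homogeneousSubmodule (Fin (m + 1)) K := by
  have hfam : IsGradedFamily (stack fun _ => homogeneousSubmodule (Fin m) K) :=
    stack_isGradedFamily (fun _ => homogeneousSubmodule_isGradedFamily) fun _ _ => le_rfl
  have htop : hfam.toIdeal = ⊤ := by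
    refine (Ideal.eq_top_iff_one _).2 (hfam.mem_toIdeal_of_mem (d := 0) ?_)
    simpa using X_last_pow_mem_stack (m := m) (K := K) (e := 0)
      (L := fun _ => homogeneousSubmodule (Fin m) K) (isHomogeneous_one (Fin m) K)
  rw [← hfam.degreePart_toIdeal, htop]
  funext d
  simp [degreePart]

theorem degreePart_extendIdeal_le_stack {I : Ideal (MvPolynomial (Fin m) K)}
    (hI : IsMonomialIdeal I) {e : ℕ∞} (hIL : ∀ i d, degreePart I d ≤ L i d)
    (he : ∀ i : ℕ, e ≤ i → L i = homogeneousSubmodule (Fin m) K) (d : ℕ) :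
    degreePart (extendIdeal I e) d ≤ stack L d := by
  classical
  -- The slices of the extended ideal: `I` below the power `e`, everything from there on.
  set c : ℕ → ℕ → Submodule K (MvPolynomial (Fin m) K) := fun i =>
    if e ≤ i then homogeneousSubmodule (Fin m) K else degreePart I with hc
  have hIc : ∀ i d, degreePart I d ≤ c i d := by
    intro i d
    simp only [hc]
    split_ifs
    · exact inf_le_right
    · exact le_rfl
  have hcL : ∀ i d, c i d ≤ L i d := by
    intro i d
    simp only [hc]
    split_ifs with h
    · rw [he i h]
    · exact hIL i d
  have hcfam : ∀ i, IsGradedFamily (c i) := by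
    intro i
    simp only [hc]
    split_ifs
    · exact homogeneousSubmodule_isGradedFamily
    · exact degreePart_isGradedFamily I
  have hfam : IsGradedFamily (stack c) := by
    refine stack_isGradedFamily hcfam fun i d => ?_
    by_cases h : e ≤ i
    · have h' : e ≤ (i + 1 : ℕ) := h.trans (by exact_mod_cast Nat.le_succ i)
      simp only [hc, if_pos h, if_pos h', le_refl]
    · have : c i = degreePart I := if_neg h
      rw [this]
      exact hIc _ _
  have hle : extendIdeal I e ≤ hfam.toIdeal := by
    refine sup_le (Ideal.map_le_iff_le_comap.2 fun f hf k => ?_) ?_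
    · rw [← rename_homogeneousComponent]
      exact map_rename_le_stack k ⟨_, hIc 0 k
        ⟨hI.homogeneousComponent_mem f hf k, homogeneousComponent_mem k f⟩, rfl⟩
    · induction e using ENat.recTopCoe with
      | top => exact bot_le
      | coe e =>
        rw [powIdeal_natCast, Ideal.span_singleton_le_iff_mem]
        refine hfam.mem_toIdeal_of_mem (X_last_pow_mem_stack ?_)
        simp only [hc, le_refl, if_true]
        exact isHomogeneous_one (Fin m) K
  refine (degreePart_mono hle d).trans ?_
  rw [hfam.degreePart_toIdeal]
  exact stack_mono fun i _ => hcL i _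

end Stack

end OneMoreVariable

/-! ### Slicing, rearranging and gluing -/

section DistractionOfExtension

variable {K : Type*} [Field K] {m : ℕ}

/-- Every graded family above a distraction of `I` has the dimensions of one above `I`. -/
theorem exists_isGradedFamily_above {I : Ideal (MvPolynomial (Fin m) K)} (hI : IsMonomialIdeal I)
    (D : Distraction K m)
    (hD : hilbertPoset (quotGrading (D.onIdeal I)) = hilbertPoset (quotGrading I))
    {W : ℕ → Submodule K (MvPolynomial (Fin m) K)} (hW : IsGradedFamily W)
    (hIW : ∀ d, degreePart (D.onIdeal I) d ≤ W d) :
    ∃ W', IsGradedFamily W' ∧ (∀ d, degreePart I d ≤ W' d) ∧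
      ∀ d, Module.finrank K (W' d) = Module.finrank K (W d) := by
  have hle : ∀ d, Module.finrank K (degreePart I d) ≤ Module.finrank K (W d) := by
    intro d
    have := hW.finite d
    rw [← D.finrank_degreePart_onIdeal hI]
    exact Submodule.finrank_mono (hIW d)
  have hmem : (fun d => Module.finrank K (W d) - Module.finrank K (degreePart I d)) ∈
      hilbertPoset (quotGrading (D.onIdeal I)) :=
    (D.mem_hilbertPoset_onIdeal hI).2 ⟨W, hW, hIW, fun d => Nat.sub_add_cancel (hle d)⟩
  rw [hD, mem_hilbertPoset_quotGrading hI.homogeneousComponent_mem] at hmem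
  obtain ⟨W', hW', hIW', h⟩ := hmem
  exact ⟨W', hW', hIW', fun d => by rw [← h d, Nat.sub_add_cancel (hle d)]⟩

/-- The sequence of graded families that starts with `W` and goes on with `L`. -/
def consFamily (W : ℕ → Submodule K (MvPolynomial (Fin m) K))
    (L : ℕ → ℕ → Submodule K (MvPolynomial (Fin m) K)) :
    ℕ → ℕ → Submodule K (MvPolynomial (Fin m) K)
  | 0 => W
  | i + 1 => L i

theorem forall_consFamily {W : ℕ → Submodule K (MvPolynomial (Fin m) K)}
    {L : ℕ → ℕ → Submodule K (MvPolynomial (Fin m) K)}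
    {P : (ℕ → Submodule K (MvPolynomial (Fin m) K)) → Prop} (hW : P W) (hL : ∀ i, P (L i)) :
    ∀ i, P (consFamily W L i)
  | 0 => hW
  | i + 1 => hL i

/-- The slices of `J` along the entries of the last row indexed by `s`, taken in an order which
makes the dimensions increase, rearranged with a flag map. -/
theorem exists_stack_finrank_eq {I : Ideal (MvPolynomial (Fin m) K)} (hI : IsMonomialIdeal I)
    (E : FlagMap I)
    (hdist : ∀ D : Distraction K m,
      hilbertPoset (quotGrading (D.onIdeal I)) = hilbertPoset (quotGrading I))
    (D : Distraction K (m + 1)) (π : ∀ j, LinearProjection (D.entry (Fin.last m) j))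
    (N : ℕ) (s : Finset ℕ) (hs : s.card = N) (d : ℕ) (J : Ideal (MvPolynomial (Fin (m + 1)) K))
    (hIJ : ∀ a, monomial a (1 : K) ∈ I → D.onMonomial (a.mapDomain Fin.castSucc) ∈ J)
    (hsJ : ∏ j ∈ s, D.entry (Fin.last m) j ∈ J) :
    ∃ L : ℕ → ℕ → Submodule K (MvPolynomial (Fin m) K),
      (∀ i, IsGradedFamily (L i)) ∧ (∀ i d, degreePart I d ≤ L i d) ∧
      (∀ i, N ≤ i → L i = homogeneousSubmodule (Fin m) K) ∧
      Module.finrank K (stack L d) = Module.finrank K (degreePart J d) ∧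
      (∀ k, d = k + 1 → Module.finrank K (stack L k) = Module.finrank K (degreePart J k) ∧
        ∀ i ≤ k, L i (k - i) ≤ L (i + 1) (k - i)) ∧
      ∀ W, IsGradedFamily W → (∀ d, degreePart I d ≤ W d) →
        (∀ j ∈ s, Module.finrank K (W d) ≤ Module.finrank K ((π j).image J d)) →
        E.toFun W d ≤ L 0 d := by
  classical
  induction N generalizing s d J with
  | zero =>
    obtain rfl := Finset.card_eq_zero.1 hs
    obtain rfl : J = ⊤ := (Ideal.eq_top_iff_one _).2 (by simpa using hsJ)
    have htop : degreePart (⊤ : Ideal (MvPolynomial (Fin (m + 1)) K)) =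
        homogeneousSubmodule (Fin (m + 1)) K := by
      funext d
      simp [degreePart]
    refine ⟨fun _ => homogeneousSubmodule (Fin m) K,
      fun _ => homogeneousSubmodule_isGradedFamily, fun _ _ => inf_le_right, fun _ _ => rfl, ?_,
      fun k _ => ⟨?_, fun _ _ => le_rfl⟩, fun W h1 h2 _ => (E.isGradedFamily W h1 h2).le d⟩
    all_goals rw [stack_homogeneousSubmodule, htop]
  | succ N ih =>
    -- Each slice lies above a distraction of `I`; the hypothesis trades it for a family above `I`
    -- with the same dimensions.
    have hslice : ∀ j, ∃ W, IsGradedFamily W ∧ (∀ d, degreePart I d ≤ W d) ∧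
        ∀ d, Module.finrank K (W d) = Module.finrank K ((π j).image J d) := fun j =>
      exists_isGradedFamily_above hI (D.restrict (π j)) (hdist _) ((π j).image_isGradedFamily J)
        (D.onIdeal_restrict_le_image (π j) hIJ)
    have hne : s.Nonempty := Finset.card_pos.1 (by omega)
    cases d with
    | zero =>
      obtain ⟨j, hj⟩ := hne
      obtain ⟨W, hW, hIW, hWrank⟩ := hslice j
      -- In degree `0` only `L 0` enters the stack; the later slices are filler meeting the side
      -- conditions.
      set T : ℕ → ℕ → Submodule K (MvPolynomial (Fin m) K) := fun i =>
        if N ≤ i then homogeneousSubmodule (Fin m) K else degreePart I with hT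
      refine ⟨consFamily (E.toFun W) T,
        forall_consFamily (E.isGradedFamily W hW hIW) fun i => ?_,
        forall_consFamily (P := fun V => ∀ d, degreePart I d ≤ V d) (E.le W hW hIW) fun i d => ?_,
        fun i hi => ?_, ?_, fun k hk => absurd hk (by omega),
        fun V hV hIV h => E.mono V W hV hIV hW hIW 0 ((h j hj).trans_eq (hWrank 0).symm)⟩
      · simp only [hT]
        split_ifs
        · exact homogeneousSubmodule_isGradedFamily
        · exact degreePart_isGradedFamily I
      · simp only [hT]
        split_ifs
        · exact inf_le_right
        · exact le_rfl
      · obtain ⟨i, rfl⟩ : ∃ k, i = k + 1 := ⟨i - 1, by omega⟩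
        exact if_pos (by omega)
      · rw [finrank_stack_zero, ← (π j).finrank_image_zero, ← hWrank]
        exact E.finrank_eq W hW hIW 0
    | succ d =>
      -- The slice is minimised in degree `d`, where it must fit inside the next one, not in the top
      -- degree `d + 1`.
      obtain ⟨j, hj, hmin⟩ := Finset.exists_min_image s
        (fun j => Module.finrank K ((π j).image J d)) hne
      obtain ⟨W, hW, hIW, hWrank⟩ := hslice j
      set J' := colonElement J (D.entry (Fin.last m) j) with hJ'
      have hJJ' : J ≤ J' := le_colonElement _ _
      obtain ⟨L, hL, hIL, hLtop, hLd, hLk, hLE⟩ := ih (s.erase j)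
        (by rw [Finset.card_erase_of_mem hj]; omega) d J' (fun a ha => hJJ' (hIJ a ha))
        (by rw [hJ', mem_colonElement, Finset.mul_prod_erase s _ hj]; exact hsJ)
      have hfam : ∀ i, IsGradedFamily (consFamily (E.toFun W) L i) :=
        forall_consFamily (E.isGradedFamily W hW hIW) hL
      -- The chosen slice is no larger in degree `d` than any remaining slice of `J`, hence of `J'`.
      -- So whichever entry is taken next, the last clause of the induction applies.
      have hfirst : E.toFun W d ≤ L 0 d := by
        refine hLE W hW hIW fun i hi => ?_
        have := ((π i).image_isGradedFamily J').finite d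
        rw [hWrank]
        exact (hmin i (Finset.mem_of_mem_erase hi)).trans
          (Submodule.finrank_mono ((π i).image_mono hJJ' d))
      refine ⟨consFamily (E.toFun W) L, hfam,
        forall_consFamily (P := fun V => ∀ d, degreePart I d ≤ V d) (E.le W hW hIW) hIL,
        fun i hi => ?_, ?_, ?_, fun V hV hIV h =>
          E.mono V W hV hIV hW hIW _ ((h j hj).trans_eq (hWrank _).symm)⟩
      · obtain ⟨i, rfl⟩ : ∃ k, i = k + 1 := ⟨i - 1, by omega⟩
        exact hLtop i (by omega)
      · rw [finrank_stack_succ fun i => (hfam i).le, ← (π j).finrank_image_succ, ← hWrank,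
          ← E.finrank_eq W hW hIW]
        exact congrArg _ hLd
      · rintro k hk
        obtain rfl : d = k := by omega
        refine ⟨?_, fun i hi => ?_⟩
        · cases d with
          | zero =>
            rw [finrank_stack_zero, ← (π j).finrank_image_zero, ← hWrank]
            exact E.finrank_eq W hW hIW 0
          | succ d =>
            rw [finrank_stack_succ fun i => (hfam i).le, ← (π j).finrank_image_succ, ← hWrank,
              ← E.finrank_eq W hW hIW]
            exact congrArg _ (hLk d rfl).1
        · cases i with
          | zero => exact hfirst
          | succ i =>
            obtain ⟨d, rfl⟩ : ∃ k, d = k + 1 := ⟨d - 1, by omega⟩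
            have := (hLk d rfl).2 i (by omega)
            rw [Nat.add_sub_add_right]
            exact this

/-- In two consecutive degrees, a graded family above the distraction of `I A + X_{m+1} ^ e A` has
the dimensions of a graded family above `I A + X_{m+1} ^ e A`. -/
theorem exists_isGradedFamily_above_extendIdeal {I : Ideal (MvPolynomial (Fin m) K)}
    (hI : IsMonomialIdeal I) (e : ℕ∞) (E : FlagMap I)
    (hdist : ∀ D : Distraction K m,
      hilbertPoset (quotGrading (D.onIdeal I)) = hilbertPoset (quotGrading I))
    (D : Distraction K (m + 1)) {W : ℕ → Submodule K (MvPolynomial (Fin (m + 1)) K)}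
    (hW : IsGradedFamily W) (hDW : ∀ d, degreePart (D.onIdeal (extendIdeal I e)) d ≤ W d)
    (d : ℕ) :
    ∃ V, IsGradedFamily V ∧ (∀ d, degreePart (extendIdeal I e) d ≤ V d) ∧
      Module.finrank K (V d) = Module.finrank K (W d) ∧
      Module.finrank K (V (d + 1)) = Module.finrank K (W (d + 1)) := by
  have hfull := homogeneousSubmodule_isGradedFamily (K := K) (n := m + 1)
  -- Filling up from degree `d + 2` leaves degrees `d` and `d + 1` intact and, when `e = ∞`, puts a
  -- product of `d + 2` entries of the last row into `J`.
  have hW' := hW.truncate_below hfull hW.le (d + 2)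
  set J := hW'.toIdeal with hJ
  have hJk : ∀ k < d + 2, degreePart J k = W k := by
    intro k hk
    rw [hJ, hW'.degreePart_toIdeal]
    exact if_pos hk
  have hDJ : D.onIdeal (extendIdeal I e) ≤ J := by
    refine hW'.le_toIdeal (D.homogeneousComponent_mem_onIdeal _) fun k => ?_
    split_ifs
    · exact hDW k
    · exact inf_le_right
  have hIJ : ∀ a, monomial a (1 : K) ∈ I → D.onMonomial (a.mapDomain Fin.castSucc) ∈ J :=
    fun a ha => hDJ (Ideal.subset_span ⟨_, monomial_mapDomain_mem_extendIdeal e ha, rfl⟩)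
  have hlast : ∀ N, D.onMonomial (Finsupp.single (Fin.last m) N) =
      ∏ j ∈ Finset.range N, D.entry (Fin.last m) j := by
    intro N
    rw [Distraction.onMonomial, Fin.prod_univ_castSucc]
    simp [Finsupp.single_eq_of_ne (Fin.castSucc_ne_last _)]
  obtain ⟨N, hNe, hNJ⟩ : ∃ N : ℕ, (N : ℕ∞) ≤ e ∧
      ∏ j ∈ Finset.range N, D.entry (Fin.last m) j ∈ J := by
    simp only [← hlast]
    induction e using ENat.recTopCoe with
    | top =>
      refine ⟨d + 2, le_top, hW'.mem_toIdeal_of_mem (d := d + 2) ?_⟩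
      rw [if_neg (lt_irrefl _)]
      simpa using D.onMonomial_isHomogeneous (Finsupp.single (Fin.last m) (d + 2))
    | coe e =>
      exact ⟨e, le_rfl, hDJ
        (Ideal.subset_span ⟨_, monomial_single_last_mem_extendIdeal I e, rfl⟩)⟩
  obtain ⟨L, hL, hIL, hLtop, hL1, hL0, -⟩ := exists_stack_finrank_eq hI E hdist D
    (fun j => (D.nonempty_linearProjection j).some) N (Finset.range N) (Finset.card_range N)
    (d + 1) J hIJ hNJ
  obtain ⟨hL0, hLstep⟩ := hL0 d rfl
  have hle : ∀ k, degreePart (extendIdeal I e) k ≤ stack L k :=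
    degreePart_extendIdeal_le_stack hI hIL fun i hi => hLtop i (by exact_mod_cast hNe.trans hi)
  have hc := degreePart_isGradedFamily (extendIdeal I e)
  have hstack : ∀ k, stack L k ≤ homogeneousSubmodule (Fin (m + 1)) K k :=
    stack_le fun i => (hL i).le
  -- The stack is known to be stable only from degree `d` to `d + 1`, so it is used in these two
  -- degrees alone, with the smallest possible family below and the largest above.
  obtain ⟨V, hV⟩ : ∃ V : ℕ → Submodule K (MvPolynomial (Fin (m + 1)) K), ∀ k, V k =
      if k < d then degreePart (extendIdeal I e) k else
        if k < d + 2 then stack L k else homogeneousSubmodule (Fin (m + 1)) K k :=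
    ⟨_, fun _ => rfl⟩
  have hVd : V d = stack L d := by rw [hV, if_neg (lt_irrefl _), if_pos (by omega)]
  have hVd' : V (d + 1) = stack L (d + 1) := by rw [hV, if_neg (by omega), if_pos (by omega)]
  have hVlow : ∀ k < d, V k = degreePart (extendIdeal I e) k := fun k hk => by
    rw [hV, if_pos hk]
  have hVhigh : ∀ k, d + 2 ≤ k → V k = homogeneousSubmodule (Fin (m + 1)) K k := fun k hk => by
    rw [hV, if_neg (by omega), if_neg (by omega)]
  have hVle : ∀ k, V k ≤ homogeneousSubmodule (Fin (m + 1)) K k := by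
    intro k
    rw [hV]
    split_ifs
    · exact hc.le k
    · exact hstack k
    · exact le_rfl
  have hcV : ∀ k, degreePart (extendIdeal I e) k ≤ V k := by
    intro k
    rw [hV]
    split_ifs
    · exact le_rfl
    · exact hle k
    · exact hc.le k
  refine ⟨V, ⟨hVle, fun k i f hf => ?_⟩, hcV, ?_, ?_⟩
  · rcases lt_trichotomy k d with hk | rfl | hk
    · rw [hVlow k hk] at hf
      exact hcV _ (hc.X_mul_mem k i f hf)
    · rw [hVd] at hf
      rw [hVd']
      exact X_mul_mem_stack hL hLstep i hf
    · rw [hVhigh _ (by omega)]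
      exact hfull.X_mul_mem k i f (hVle k hf)
  · rw [hVd, hL0, hJk d (by omega)]
  · rw [hVd', hL1, hJk (d + 1) (by omega)]

/-- With a flag map above `c`, dimensions need to be matched only in consecutive degrees. -/
theorem FlagMap.exists_isGradedFamily {n : ℕ} {c : Ideal (MvPolynomial (Fin n) K)}
    (E : FlagMap c) {h : ℕ → ℕ}
    (hloc : ∀ d, ∃ V, IsGradedFamily V ∧ (∀ d, degreePart c d ≤ V d) ∧
      Module.finrank K (V d) = h d ∧ Module.finrank K (V (d + 1)) = h (d + 1)) :
    ∃ V, IsGradedFamily V ∧ (∀ d, degreePart c d ≤ V d) ∧ ∀ d, Module.finrank K (V d) = h d := by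
  choose V hV hcV hd hd' using hloc
  -- Take degree `d` from the image of `V d`. Multiplication by a variable lands in degree `d + 1`
  -- of that same image, which lies in the piece coming from `V (d + 1)` because both families have
  -- dimension `h (d + 1)` there.
  refine ⟨fun d => E.toFun (V d) d, ⟨fun d => (E.isGradedFamily _ (hV d) (hcV d)).le d,
    fun d i f hf => ?_⟩, fun d => E.le _ (hV d) (hcV d) d,
    fun d => (E.finrank_eq _ (hV d) (hcV d) d).trans (hd d)⟩
  refine E.mono _ _ (hV d) (hcV d) (hV (d + 1)) (hcV (d + 1)) (d + 1) ?_
    ((E.isGradedFamily _ (hV d) (hcV d)).X_mul_mem d i f hf)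
  rw [hd', hd]

end DistractionOfExtension

theorem theorem4p2 {K : Type*} [Field K] (m : ℕ)
    (abar : Ideal (MvPolynomial (Fin m) K)) (habar : IsMonomialIdeal abar) (e : ℕ∞)
    (hRbar : HasHilbertEmbedding (quotGrading abar))
    (hR : HasHilbertEmbedding (quotGrading (extendIdeal abar e)))
    (hdist : ∀ Dbar : Distraction K m,
      hilbertPoset (quotGrading (Dbar.onIdeal abar)) = hilbertPoset (quotGrading abar))
    (D : Distraction K (m + 1)) :
    hilbertPoset (quotGrading (D.onIdeal (extendIdeal abar e))) =
      hilbertPoset (quotGrading (extendIdeal abar e)) := by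
  have ha := extendIdeal_isMonomialIdeal habar e
  obtain ⟨Ebar⟩ := hRbar.nonempty_flagMap habar.homogeneousComponent_mem
  obtain ⟨E⟩ := hR.nonempty_flagMap ha.homogeneousComponent_mem
  refine Set.Subset.antisymm (fun H hH => ?_) (D.hilbertPoset_subset_onIdeal ha)
  obtain ⟨W, hW, hDW, hHW⟩ := (D.mem_hilbertPoset_onIdeal ha).1 hH
  obtain ⟨V, hV, haV, hVW⟩ := E.exists_isGradedFamily
    (exists_isGradedFamily_above_extendIdeal habar e Ebar hdist D hW hDW)
  exact (mem_hilbertPoset_quotGrading ha.homogeneousComponent_mem).2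
    ⟨V, hV, haV, fun d => by rw [hHW, hVW]⟩

end
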